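/- Let $G$ be a countable group. A \emph{map sequence} for $G$ is a sequence $\Sigma=\{\sigma_i\}_{i\ge1}$ of maps (not necessarily homomorphisms) $\sigma_i:G\to\mathrm{Sym}(m_i)$, $m_i\ge 1$, with $m_i\to\infty$. It is a \emph{sofic approximation} to $G$ if there are subsets $F_1\subset F_2\subset\cdots$ of $G$ with $\bigcup_iF_i=G$ and reals $\epsilon_i\to0$ such that for every $i$ at least $(1-\epsilon_i)m_i$ points $v\in\{1,\dots,m_i\}$ satisfy $\sigma_i(f_1)\sigma_i(f_2)v=\sigma_i(f_1f_2)v$ for all $f_1,f_2\in F_i$ and $\sigma_i(f_1)v\neq\sigma_i(f_2)v$ for all $f_1\ne f_2$ in $F_i$. (The group $G$ is sofic if it has a sofic approximation; if $G$ is infinite, $m_i\to\infty$ is automatic.) A \emph{$G$-system} $(G,X,\mu)$ is a probability space $(X,\mu)$ with a measure-preserving action of $G$. Partitions of $X$ are measurable, ordered and at most countable; empty atoms are allowed. Put $H(\alpha)=-\sum_{i}\mu(A_i)\log\mu(A_i)\in[0,\infty]$ for $\alpha=(A_1,A_2,\dots)$. The partition $\alpha$ is \emph{generating} if every measurable set agrees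 up to a $\mu$-null set with a member of the smallest $G$-invariant $\sigma$-algebra containing the atoms of $\alpha$. A partition $\alpha$ \emph{refines} $\beta$, written $\beta\le\alpha$, if each atom of $\alpha$ is contained, up to a null set, in an atom of $\beta$. For a finite partition $\alpha=(A_1,\dots,A_u)$, a finite $F\subset G$, $\epsilon>0$ and $\sigma:G\to\mathrm{Sym}(m)$, let $\mathcal{AP}(\sigma,\alpha:F,\epsilon)$ be the set of ordered partitions $(B_1,\dots,B_u)$ of $\{1,\dots,m\}$ with $$\sum_{\phi:F\to\{1,\dots,u\}}\Big|\mu\Big(\bigcap_{f\in F}fA_{\phi(f)}\Big)-\frac1m\Big|\bigcap_{f\in F}\sigma(f)B_{\phi(f)}\Big|\Big|\le\epsilon ,$$ and put, with $\log 0=-\infty$, $$H(\Sigma,\alpha:F)=\lim_{\epsilon\to0}\ \limsup_{i\to\infty}\frac1{m_i}\log|\mathcal{AP}(\sigma_i,\alpha:F,\epsilon)| .$$ For an arbitrary partition $\alpha$, let $H(\Sigma,\alpha:F)$ be the infimum of $\lim_{n}H(\Sigma,\alpha_n:F)$ over all chains of $\alpha$, that is, sequences of finite partitions $\alpha_1\le\alpha_2\le\cdots\le\alpha$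 with $\bigvee_n\alpha_n=\alpha$ up to null sets (for which the limit exists). In both cases let $h(\Sigma,\alpha)=\inf_FH(\Sigma,\alpha:F)$ over all finite $F\subset G$. \textbf{Theorem.} Let $G$ be a countable sofic group, $\Sigma$ a sofic approximation to $G$ (with $m_i\to\infty$), and $(G,X,\mu)$ a $G$-system. (1) If $\alpha,\beta$ are generating partitions of $X$ with $H(\alpha)+H(\beta)<\infty$, then $h(\Sigma,\alpha)=h(\Sigma,\beta)$. Moreover, for a finite partition $\alpha$ the two definitions of $h(\Sigma,\alpha)$ (directly, and through chains) agree. (2) Consequently, if $(G,X,\mu)$ has a generating partition of finite entropy, then $h(\Sigma,G,X,\mu):=h(\Sigma,\alpha)$ is the same for every generating $\alpha$ with $H(\alpha)<\infty$ (if there is no such partition, $h(\Sigma,G,X,\mu)$ is undefined); and it is a measure-conjugacy invariant: if $(G,Y,\nu)$ is another $G$-system and there are conull sets $X'\subset X$, $Y'\subset Y$ and a bimeasurable bijection $\phi:X'\to Y'$ with $\phi_*\mu=\nu$ and, for all $g\in G$ and $x\in X'$, $gx\in X'$ and $\phi(gx)=g\phi(x)$, then $h(\Sigma,G,X,\mu)$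 is defined if and only if $h(\Sigma,G,Y,\nu)$ is, and in that case they are equal. -/

import Mathlib

open MeasureTheory Filter Topology
open scoped ENNReal Pointwise

noncomputable section

namespace SoficEntropy

/-- The set `V(F)` of points of `{1, …, m}` at which `σ` looks multiplicative and free on `F`. -/
def goodSet {G : Type*} [Group G] {m : ℕ} (σ : G → Equiv.Perm (Fin m)) (F : Set G) :
    Set (Fin m) :=
  {v | ∀ f₁ ∈ F, ∀ f₂ ∈ F,
    σ f₁ (σ f₂ v) = σ (f₁ * f₂) v ∧ (f₁ ≠ f₂ → σ f₁ v ≠ σ f₂ v)}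

/-- `σ` is an `(F, ε)`-approximation to `G`. -/
def IsApproximation {G : Type*} [Group G] {m : ℕ} (σ : G → Equiv.Perm (Fin m))
    (F : Set G) (ε : ℝ) : Prop :=
  (1 - ε) * (m : ℝ) ≤ ((goodSet σ F).ncard : ℝ)

/-- A map sequence for `G`: maps (not assumed to be homomorphisms) `σ i : G → Sym (m i)` with
`m i ≥ 1` and `m i → ∞`. -/
structure MapSequence (G : Type*) where
  m : ℕ → ℕ
  m_pos : ∀ i, 0 < m i
  tendsto_m : Tendsto m atTop atTop
  σ : ∀ i, G → Equiv.Perm (Fin (m i))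

/-- A sofic approximation to `G`. -/
def MapSequence.IsSoficApproximation {G : Type*} [Group G] (S : MapSequence G) : Prop :=
  ∃ (F : ℕ → Set G) (ε : ℕ → ℝ),
    (∀ i, F i ⊆ F (i + 1)) ∧ (⋃ i, F i) = Set.univ ∧ Tendsto ε atTop (𝓝 0) ∧
      ∀ i, IsApproximation (S.σ i) (F i) (ε i)

/-- An ordered measurable partition of `X` with atoms indexed by `ι`, encoded by the function
sending a point to the index of its atom. Atoms may be empty. Finite partitions with `u` atoms
are indexed by `Fin u`, at most countable ones by `ℕ`. -/
structure OrdPartition (X : Type*) [MeasurableSpace X] (ι : Type*) where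
  label : X → ι
  measurableSet_fiber : ∀ i, MeasurableSet (label ⁻¹' {i})

/-- The atom with index `i`. -/
def OrdPartition.atom {X : Type*} [MeasurableSpace X] {ι : Type*} (α : OrdPartition X ι)
    (i : ι) : Set X :=
  α.label ⁻¹' {i}

/-- A finite ordered partition regarded as a countable one, all further atoms being empty. -/
def OrdPartition.toNat {X : Type*} [MeasurableSpace X] {u : ℕ} (α : OrdPartition X (Fin u)) :
    OrdPartition X ℕ where
  label x := (α.label x : ℕ)
  measurableSet_fiber i := by
    by_cases h : i < u
    · have : (fun x => (α.label x : ℕ)) ⁻¹' {i} = α.label ⁻¹' {⟨i, h⟩} := by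
        ext x; simp [Fin.ext_iff]
      rw [this]; exact α.measurableSet_fiber _
    · have : (fun x => (α.label x : ℕ)) ⁻¹' {i} = ∅ := by
        ext x
        simp only [Set.mem_preimage, Set.mem_singleton_iff, Set.mem_empty_iff_false, iff_false]
        have := (α.label x).isLt
        omega
      rw [this]; exact MeasurableSet.empty

/-- The Shannon entropy `H(α) = -∑ μ(A_i) log μ(A_i)`, with value in `[0, ∞]`. -/
def shannonEntropy {X : Type*} [MeasurableSpace X] (μ : Measure X) (α : OrdPartition X ℕ) :
    ℝ≥0∞ :=
  ∑' i, ENNReal.ofReal (Real.negMulLog (μ.real (α.atom i)))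

open Classical in
/-- `d_F(α, β) = ∑_φ |μ(A_φ) - ζ(B_φ)|` for a finite partition `α` of `X` and a partition of
`{1, …, m}` given by its label function `b`, where `A_φ = ⋂_{f ∈ F} f A_{φ(f)}`,
`B_φ = ⋂_{f ∈ F} σ(f) B_{φ(f)}` and `ζ` is the uniform probability measure. -/
def distF {G : Type*} [Group G] {X : Type*} [MeasurableSpace X] [MulAction G X] (μ : Measure X)
    {m u : ℕ} (σ : G → Equiv.Perm (Fin m)) (F : Finset G) (α : OrdPartition X (Fin u))
    (b : Fin m → Fin u) : ℝ :=
  ∑ φ : F → Fin u,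
    |μ.real (⋂ f : F, (f : G) • α.atom (φ f)) -
      ((⋂ f : F, σ (f : G) '' (b ⁻¹' {φ f})).ncard : ℝ) / (m : ℝ)|

/-- The set `AP(σ, α : F, ε)` of approximating ordered partitions of `{1, …, m}`. -/
def approxPartitions {G : Type*} [Group G] {X : Type*} [MeasurableSpace X] [MulAction G X]
    (μ : Measure X) {m u : ℕ} (σ : G → Equiv.Perm (Fin m)) (α : OrdPartition X (Fin u))
    (F : Finset G) (ε : ℝ) : Set (Fin m → Fin u) :=
  {b | distF μ σ F α b ≤ ε}

/-- `H(Σ, α : F, ε) = limsup_i (1 / m_i) log |AP(σ_i, α : F, ε)|` for finite `α`,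
with `log 0 = -∞`. -/
def entropyFinEps {G : Type*} [Group G] {X : Type*} [MeasurableSpace X] [MulAction G X]
    (S : MapSequence G) (μ : Measure X) {u : ℕ} (α : OrdPartition X (Fin u))
    (F : Finset G) (ε : ℝ) : EReal :=
  limsup (fun i => ENNReal.log ((approxPartitions μ (S.σ i) α F ε).ncard : ℝ≥0∞) /
    (S.m i : EReal)) atTop

/-- `H(Σ, α : F)` for finite `α`: the limit as `ε → 0`, i.e. the infimum over `ε > 0`, of the
monotone quantity `H(Σ, α : F, ε)`. -/
def entropyFin {G : Type*} [Group G] {X : Type*} [MeasurableSpace X] [MulAction G X]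
    (S : MapSequence G) (μ : Measure X) {u : ℕ} (α : OrdPartition X (Fin u))
    (F : Finset G) : EReal :=
  ⨅ ε : {ε : ℝ // 0 < ε}, entropyFinEps S μ α F ε

/-- The mean `Σ`-entropy of a finite partition, computed directly. -/
def meanEntropyFin {G : Type*} [Group G] {X : Type*} [MeasurableSpace X] [MulAction G X]
    (S : MapSequence G) (μ : Measure X) {u : ℕ} (α : OrdPartition X (Fin u)) : EReal :=
  ⨅ F : Finset G, entropyFin S μ α F

/-- The partition into the fibres of `a` refines the partition into the fibres of `b`: every atom
of the first is, up to a null set, contained in an atom of the second. -/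
def Refines {X : Type*} [MeasurableSpace X] (μ : Measure X) {ι κ : Type*}
    (a : X → ι) (b : X → κ) : Prop :=
  ∀ i, ∃ j, μ (a ⁻¹' {i} \ b ⁻¹' {j}) = 0

/-- `γ` is a chain of `α`: finite partitions `γ 0 ≤ γ 1 ≤ ⋯ ≤ α` whose join is `α` up to null
sets. The join of all `γ n` is the partition into the fibres of `x ↦ (n ↦ label of x in γ n)`;
that `α` refines it follows from `α` refining every `γ n`. -/
structure IsChain {X : Type*} [MeasurableSpace X] (μ : Measure X) (α : OrdPartition X ℕ)
    (u : ℕ → ℕ) (γ : ∀ n, OrdPartition X (Fin (u n))) : Prop where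
  mono : ∀ n, Refines μ (γ (n + 1)).label (γ n).label
  le : ∀ n, Refines μ α.label (γ n).label
  join : Refines μ (fun x n => (γ n).label x) α.label

/-- `H(Σ, α : F)` for an at most countable partition `α`: the infimum of
`lim_n H(Σ, γ_n : F)` over all chains `γ` of `α`. -/
def entropyF {G : Type*} [Group G] {X : Type*} [MeasurableSpace X] [MulAction G X]
    (S : MapSequence G) (μ : Measure X) (α : OrdPartition X ℕ) (F : Finset G) : EReal :=
  sInf {L : EReal | ∃ (u : ℕ → ℕ) (γ : ∀ n, OrdPartition X (Fin (u n))), IsChain μ α u γ ∧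
    Tendsto (fun n => entropyFin S μ (γ n) F) atTop (𝓝 L)}

/-- The mean `Σ`-entropy `h(Σ, α)`. -/
def meanEntropy {G : Type*} [Group G] {X : Type*} [MeasurableSpace X] [MulAction G X]
    (S : MapSequence G) (μ : Measure X) (α : OrdPartition X ℕ) : EReal :=
  ⨅ F : Finset G, entropyF S μ α F

/-- The smallest `G`-invariant σ-algebra containing all sets of the family `A`. -/
@[reducible]
def invariantSigma (G : Type*) [Group G] {X : Type*} [MulAction G X] {ι : Type*}
    (A : ι → Set X) : MeasurableSpace X :=
  sInf {𝓜 : MeasurableSpace X |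
    (∀ (g : G) (s : Set X), MeasurableSet[𝓜] s → MeasurableSet[𝓜] (g • s)) ∧
      ∀ i, MeasurableSet[𝓜] (A i)}

/-- `α` is generating. -/
def IsGenerating (G : Type*) [Group G] {X : Type*} [MeasurableSpace X] [MulAction G X]
    (μ : Measure X) (α : OrdPartition X ℕ) : Prop :=
  ∀ A : Set X, MeasurableSet A →
    ∃ A' : Set X, MeasurableSet[invariantSigma G α.atom] A' ∧ μ (symmDiff A A') = 0

open Classical in
/-- The entropy `h(Σ, G, X, μ)` of a system: the mean entropy of a generating partition of finite
Shannon entropy if there is one, and undefined (`none`) otherwise. -/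
def systemEntropy {G : Type*} [Group G] {X : Type*} [MeasurableSpace X] [MulAction G X]
    (S : MapSequence G) (μ : Measure X) : Option EReal :=
  if h : ∃ α : OrdPartition X ℕ, IsGenerating G μ α ∧ shannonEntropy μ α < ⊤ then
    some (meanEntropy S μ h.choose)
  else none

/-- The systems `(G, X, μ)` and `(G, Y, ν)` are measurably conjugate. -/
def MeasurablyConjugate (G : Type*) [Group G] {X Y : Type*} [MeasurableSpace X] [MulAction G X]
    [MeasurableSpace Y] [MulAction G Y] (μ : Measure X) (ν : Measure Y) : Prop :=
  ∃ (X' : Set X) (Y' : Set Y) (φ : X' ≃ᵐ Y'), μ X'ᶜ = 0 ∧ ν Y'ᶜ = 0 ∧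
    (∀ B : Set Y, MeasurableSet B →
      μ (Subtype.val '' {x : X' | (φ x : Y) ∈ B}) = ν B) ∧
    ∀ (g : G) (x : X'), ∃ hx : g • (x : X) ∈ X', (φ ⟨g • (x : X), hx⟩ : Y) = g • (φ x : Y)

end SoficEntropy

end

/-! Let `α` and `β` generate, with `α` of finite entropy, and let `δ n` be a chain of `β`. Since `β`
generates, a fixed coarse truncation of `α` is, up to small measure, a finite block code `d` of `δ
n` for large `n`; since `α` generates, `δ n` is almost a finite block code `c` of every sufficiently
fine truncation of `α`. A sofic approximation is multiplicative at most points, so applying `c` to a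
good model of a fine truncation gives a good model of `δ n` (`distF_code_le`).

It remains to bound the fibres of this map. The code `d` recovers the coarse labels off a small set
of points (`freq_decode_le`), so what is lost is essentially the position inside the tail of `α`,
whose cost is a tail of the convergent series for the entropy. A product-weight count
(`ncard_le_of_weights`, with the weights of `exists_truncation_weights`) makes each fibre
subexponential up to an arbitrarily small rate. The result is `entropyFin_le_of_codes`, hence
`meanEntropy_le_of_isGenerating`, and equality by symmetry.

The infimum over chains is taken at a fixed window, so the window of `c` must not depend on the
truncation; this is why `Approximable` fixes the window before `n`. Finite partitions use the same
comparison with trivial weights, and conjugacy invariance follows by pulling partitions and chains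
back. -/

namespace SoficEntropy

/-! ### Relative frequencies in a finite set -/

/-- The uniform probability of a subset of `{1, …, m}`. -/
noncomputable def freq {m : ℕ} (s : Set (Fin m)) : ℝ := (s.ncard : ℝ) / m

theorem freq_mono {m : ℕ} {s t : Set (Fin m)} (h : s ⊆ t) : freq s ≤ freq t := by
  unfold freq
  gcongr
  exact Set.toFinite t

theorem freq_union_le {m : ℕ} (s t : Set (Fin m)) : freq (s ∪ t) ≤ freq s + freq t := by
  unfold freq
  rw [← add_div]
  gcongr
  exact_mod_cast Set.ncard_union_le s t

theorem freq_image_perm {m : ℕ} (e : Equiv.Perm (Fin m)) (s : Set (Fin m)) :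
    freq (e '' s) = freq s := by
  unfold freq
  rw [Set.ncard_image_of_injective s e.injective]

theorem sum_freq_preimage_singleton {m : ℕ} {κ : Type*} (T : Fin m → κ) (s : Finset κ) :
    ∑ y ∈ s, freq (T ⁻¹' {y}) = freq (T ⁻¹' (s : Set κ)) := by
  classical
  unfold freq
  rw [← Finset.sum_div]
  congr 1
  norm_cast
  rw [Set.ncard_eq_toFinset_card', Finset.card_eq_sum_card_fiberwise (f := T) (t := s)]
  · refine Finset.sum_congr rfl fun y hy => ?_
    rw [Set.ncard_eq_toFinset_card']
    congr 1
    ext v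
    simp only [Set.mem_toFinset, Set.mem_preimage, Set.mem_singleton_iff, Finset.mem_filter,
      Finset.mem_coe]
    constructor
    · rintro rfl; exact ⟨hy, rfl⟩
    · exact fun h => h.2
  · intro v hv
    simpa using hv

theorem freq_biUnion_le {m : ℕ} {κ : Type*} (s : Finset κ) (A : κ → Set (Fin m)) :
    freq (⋃ y ∈ s, A y) ≤ ∑ y ∈ s, freq (A y) := by
  classical
  induction s using Finset.induction_on with
  | empty => simp [freq]
  | insert a s ha ih =>
    rw [Finset.set_biUnion_insert, Finset.sum_insert ha]
    exact (freq_union_le _ _).trans (by gcongr)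

theorem freq_abs_sub_le {m : ℕ} {s t e : Set (Fin m)} (h : ∀ v ∉ e, v ∈ s ↔ v ∈ t) :
    |freq s - freq t| ≤ freq e := by
  have h₁ : freq s ≤ freq t + freq e := by
    refine (freq_mono fun v hv => ?_).trans (freq_union_le t e)
    by_cases hve : v ∈ e
    · exact Or.inr hve
    · exact Or.inl ((h v hve).1 hv)
  have h₂ : freq t ≤ freq s + freq e := by
    refine (freq_mono fun v hv => ?_).trans (freq_union_le s e)
    by_cases hve : v ∈ e
    · exact Or.inr hve
    · exact Or.inl ((h v hve).2 hv)
  rw [abs_le]; constructor <;> linarith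

theorem measureReal_abs_sub_le {X : Type*} [MeasurableSpace X] (μ : Measure X)
    [IsFiniteMeasure μ] {s t e : Set X} (h : ∀ x ∉ e, x ∈ s ↔ x ∈ t) :
    |μ.real s - μ.real t| ≤ μ.real e := by
  have h₁ : μ.real s ≤ μ.real t + μ.real e := by
    refine (measureReal_mono fun v hv => ?_).trans (measureReal_union_le t e)
    by_cases hve : v ∈ e
    · exact Or.inr hve
    · exact Or.inl ((h v hve).1 hv)
  have h₂ : μ.real t ≤ μ.real s + μ.real e := by
    refine (measureReal_mono fun v hv => ?_).trans (measureReal_union_le s e)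
    by_cases hve : v ∈ e
    · exact Or.inr hve
    · exact Or.inl ((h v hve).2 hv)
  rw [abs_le]; constructor <;> linarith

/-! ### Itineraries -/

/-- The itinerary `g ↦ α(g⁻¹ x)` of a point with respect to a partition. -/
def itinerary (G : Type*) [Group G] {X : Type*} [MeasurableSpace X] [MulAction G X] {ι : Type*}
    (α : OrdPartition X ι) (x : X) : G → ι :=
  fun g => α.label (g⁻¹ • x)

/-- The itinerary of a point of the finite model `{1, …, m}`. -/
def modelItinerary {G : Type*} {m : ℕ} (σ : G → Equiv.Perm (Fin m)) {ι : Type*}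
    (b : Fin m → ι) (v : Fin m) : G → ι :=
  fun g => b ((σ g)⁻¹ v)

/-- The equivariant extension of a block code. -/
def codeMap {G : Type*} [Group G] {ι κ : Type*} (c : (G → ι) → κ) (w : G → ι) : G → κ :=
  fun g => c fun h => w (g * h)

theorem iInter_image_fiber {G : Type*} {m : ℕ} (σ : G → Equiv.Perm (Fin m)) {ι : Type*} (b : Fin m → ι)
    (F : Finset G) (φ : F → ι) :
    (⋂ f : F, σ (f : G) '' (b ⁻¹' {φ f})) =
      (fun v => fun f : F => modelItinerary σ b v (f : G)) ⁻¹' {φ} := by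
  ext v
  simp only [Set.mem_iInter, Set.mem_preimage, Set.mem_singleton_iff, funext_iff, modelItinerary]
  refine forall_congr' fun f => ?_
  rw [Equiv.image_eq_preimage_symm]
  rfl

/-- Moves a finite-window event to the words on `F`, where for a finite alphabet probabilities
become finite sums. -/
theorem preimage_restrict_of_dependsOn {G : Type*} {ι : Type*} {Z : Type*} (T : Z → G → ι) {F : Finset G}
    {E : Set (G → ι)} (hE : DependsOn (fun w => w ∈ E) (F : Set G)) :
    {z | T z ∈ E} =
      (fun z => fun f : F => T z (f : G)) ⁻¹' {φ | ∃ w ∈ E, ∀ f : F, w f = φ f} := by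
  ext z
  simp only [Set.mem_ofPred_eq, Set.mem_preimage]
  constructor
  · exact fun h => ⟨_, h, fun _ => rfl⟩
  · rintro ⟨w, hw, h⟩
    have : (w ∈ E) = (T z ∈ E) := hE fun f hf => h ⟨f, hf⟩
    exact this ▸ hw

section

variable {G : Type*} [Group G] {X : Type*} [MeasurableSpace X] [MulAction G X]

theorem OrdPartition.measurable_label {ι : Type*} [Countable ι] [MeasurableSpace ι]
    (α : OrdPartition X ι) : Measurable α.label :=
  measurable_to_countable' α.measurableSet_fiber

theorem itinerary_inv_smul {ι : Type*} (α : OrdPartition X ι) (g : G) (x : X) :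
    itinerary G α (g⁻¹ • x) = fun h => itinerary G α x (g * h) := by
  funext h
  simp [itinerary, mul_smul]

theorem codeMap_itinerary {ι κ : Type*} (α : OrdPartition X ι) (c : (G → ι) → κ) (x : X) (g : G) :
    codeMap c (itinerary G α x) g = c (itinerary G α (g⁻¹ • x)) := by
  rw [itinerary_inv_smul]; rfl

theorem iInter_smul_atom {ι : Type*} (α : OrdPartition X ι) (F : Finset G) (φ : F → ι) :
    (⋂ f : F, (f : G) • α.atom (φ f)) =
      (fun x => fun f : F => itinerary G α x (f : G)) ⁻¹' {φ} := by
  ext x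
  simp [Set.mem_smul_set_iff_inv_smul_mem, OrdPartition.atom, itinerary, funext_iff]

-- Atoms of the join over `F` are fibres of the itinerary restricted to `F`; thus `distF` is the ℓ¹
-- distance between the two laws of that restriction.
open Classical in
theorem distF_eq (μ : Measure X) {m u : ℕ} (σ : G → Equiv.Perm (Fin m)) (F : Finset G)
    (α : OrdPartition X (Fin u)) (b : Fin m → Fin u) :
    distF μ σ F α b = ∑ φ : F → Fin u,
      |μ.real ((fun x => fun f : F => itinerary G α x (f : G)) ⁻¹' {φ}) -
        freq ((fun v => fun f : F => modelItinerary σ b v (f : G)) ⁻¹' {φ})| := by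
  unfold distF freq
  simp only [iInter_smul_atom, iInter_image_fiber]

variable [MeasurableConstSMul G X]

theorem measurableSet_itinerary_fiber {ι : Type*} (α : OrdPartition X ι)
    (F : Finset G) (φ : F → ι) :
    MeasurableSet ((fun x => fun f : F => itinerary G α x (f : G)) ⁻¹' {φ}) := by
  rw [← iInter_smul_atom]
  exact MeasurableSet.iInter fun f => (α.measurableSet_fiber _).const_smul _

theorem abs_sub_le_distF (μ : Measure X) [IsFiniteMeasure μ] {m u : ℕ}
    (σ : G → Equiv.Perm (Fin m)) {F : Finset G} (α : OrdPartition X (Fin u)) (b : Fin m → Fin u)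
    {E : Set (G → Fin u)} (hE : DependsOn (fun w => w ∈ E) (F : Set G)) :
    |μ.real {x | itinerary G α x ∈ E} - freq {v | modelItinerary σ b v ∈ E}| ≤
      distF μ σ F α b := by
  classical
  rw [distF_eq, preimage_restrict_of_dependsOn _ hE, preimage_restrict_of_dependsOn _ hE]
  set D := {φ : F → Fin u | ∃ w ∈ E, ∀ f : F, w f = φ f}
  have hD : D = (D.toFinset : Set (F → Fin u)) := by simp
  rw [hD, ← sum_freq_preimage_singleton, ← sum_measureReal_preimage_singleton _
    (fun φ _ => measurableSet_itinerary_fiber α F φ), ← Finset.sum_sub_distrib]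
  refine (Finset.abs_sum_le_sum_abs _ _).trans ?_
  exact Finset.sum_le_sum_of_subset_of_nonneg (Finset.subset_univ _) fun _ _ _ => abs_nonneg _

/-- The ℓ¹ distance splits into the words where the first law dominates and those where it does not;
each part is the discrepancy of a single event, whence the factor 2. -/
theorem distF_le_of_events (μ : Measure X) [IsFiniteMeasure μ] {m u : ℕ}
    (σ : G → Equiv.Perm (Fin m)) {F : Finset G} (α : OrdPartition X (Fin u)) (b : Fin m → Fin u)
    {η : ℝ} (h : ∀ E : Set (G → Fin u), DependsOn (fun w => w ∈ E) (F : Set G) →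
      |μ.real {x | itinerary G α x ∈ E} - freq {v | modelItinerary σ b v ∈ E}| ≤ η) :
    distF μ σ F α b ≤ 2 * η := by
  classical
  rw [distF_eq]
  set p : (F → Fin u) → ℝ := fun φ =>
    μ.real ((fun x => fun f : F => itinerary G α x (f : G)) ⁻¹' {φ})
  set q : (F → Fin u) → ℝ := fun φ =>
    freq ((fun v => fun f : F => modelItinerary σ b v (f : G)) ⁻¹' {φ})
  have key : ∀ D : Finset (F → Fin u), |∑ φ ∈ D, (p φ - q φ)| ≤ η := by
    intro D
    have := h {w | (fun f : F => w f) ∈ D} (by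
      intro w w' hww
      have : (fun f : F => w f) = fun f : F => w' f := funext fun f => hww f f.2
      simp [this])
    rw [Finset.sum_sub_distrib, sum_freq_preimage_singleton, sum_measureReal_preimage_singleton _
      (fun φ _ => measurableSet_itinerary_fiber α F φ)]
    exact this
  have h₁ := key (Finset.univ.filter fun φ => q φ ≤ p φ)
  have h₂ := key (Finset.univ.filter fun φ => ¬ q φ ≤ p φ)
  rw [← Finset.sum_filter_add_sum_filter_not Finset.univ (fun φ => q φ ≤ p φ)]
  have e₁ : ∑ φ with q φ ≤ p φ, |p φ - q φ| = ∑ φ with q φ ≤ p φ, (p φ - q φ) :=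
    Finset.sum_congr rfl fun φ hφ => abs_of_nonneg (sub_nonneg.2 (Finset.mem_filter.1 hφ).2)
  have e₂ : ∑ φ with ¬ q φ ≤ p φ, |p φ - q φ| = -∑ φ with ¬ q φ ≤ p φ, (p φ - q φ) := by
    rw [← Finset.sum_neg_distrib]
    exact Finset.sum_congr rfl fun φ hφ =>
      abs_of_neg (sub_neg.2 (not_le.1 (Finset.mem_filter.1 hφ).2))
  rw [e₁, e₂]
  have := le_abs_self (∑ φ with q φ ≤ p φ, (p φ - q φ))
  have := neg_le_abs (∑ φ with ¬ q φ ≤ p φ, (p φ - q φ))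
  linarith

end

/-! ### Counting with weights -/

/-- The total product weight of all labelings is the product of the row sums, at most `exp (m * s)`,
while each member of `B` contributes at least `exp (-K)`. -/
theorem ncard_le_of_weights {m u : ℕ} (W : Fin m → Fin u → ℝ) (hW : ∀ v i, 0 < W v i) {s K : ℝ}
    (hs : ∀ v, ∑ i, W v i ≤ Real.exp s) (B : Set (Fin m → Fin u))
    (hB : ∀ b ∈ B, ∑ v, -Real.log (W v (b v)) ≤ K) :
    (B.ncard : ℝ) ≤ Real.exp (m * s + K) := by
  classical
  have h₁ : ∑ b : Fin m → Fin u, ∏ v, W v (b v) ≤ Real.exp (m * s) := by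
    have := Finset.prod_univ_sum (fun _ : Fin m => (Finset.univ : Finset (Fin u))) W
    rw [Fintype.piFinset_univ] at this
    rw [← this]
    calc ∏ v, ∑ i, W v i ≤ ∏ _v : Fin m, Real.exp s :=
          Finset.prod_le_prod (fun v _ => Finset.sum_nonneg fun i _ => (hW v i).le)
            fun v _ => hs v
      _ = Real.exp (m * s) := by simp [Real.exp_nat_mul]
  have h₂ : (B.ncard : ℝ) * Real.exp (-K) ≤ ∑ b : Fin m → Fin u, ∏ v, W v (b v) := by
    rw [Set.ncard_eq_toFinset_card', ← nsmul_eq_mul]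
    calc B.toFinset.card • Real.exp (-K) ≤ ∑ b ∈ B.toFinset, ∏ v, W v (b v) := by
          refine Finset.card_nsmul_le_sum _ _ _ fun b hb => ?_
          have h := hB b (by simpa using hb)
          rw [Finset.sum_neg_distrib] at h
          have : ∏ v, W v (b v) = Real.exp (∑ v, Real.log (W v (b v))) := by
            rw [Real.exp_sum]
            exact Finset.prod_congr rfl fun v _ => (Real.exp_log (hW v _)).symm
          rw [this]
          exact Real.exp_le_exp.2 (by linarith)
      _ ≤ _ := Finset.sum_le_sum_of_subset_of_nonneg (Finset.subset_univ _) fun b _ _ =>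
          Finset.prod_nonneg fun v _ => (hW v _).le
  have h₃ := h₂.trans h₁
  rw [Real.exp_add, ← div_le_iff₀ (Real.exp_pos K), div_eq_mul_inv, ← Real.exp_neg]
  exact h₃

/-! ### Almost multiplicative points -/

theorem goodSet_anti {G : Type*} [Group G] {m : ℕ} (σ : G → Equiv.Perm (Fin m)) {F F' : Set G}
    (h : F ⊆ F') : goodSet σ F' ⊆ goodSet σ F :=
  fun _ hv f₁ h₁ f₂ h₂ => hv f₁ (h h₁) f₂ (h h₂)

theorem freq_compl_goodSet_le {G : Type*} [Group G] {m : ℕ} (hm : 0 < m)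
    (σ : G → Equiv.Perm (Fin m)) {F : Set G} {ε : ℝ} (h : IsApproximation σ F ε) :
    freq (goodSet σ F)ᶜ ≤ ε := by
  unfold IsApproximation at h
  have hc : (goodSet σ F).ncard + (goodSet σ F)ᶜ.ncard = m := by
    simpa using Set.ncard_add_ncard_compl (goodSet σ F)
  have hc' : ((goodSet σ F).ncard : ℝ) + ((goodSet σ F)ᶜ.ncard : ℝ) = m := by exact_mod_cast hc
  have hm' : (0 : ℝ) < m := by exact_mod_cast hm
  unfold freq
  rw [div_le_iff₀ hm']
  linarith

theorem MapSequence.IsSoficApproximation.eventually_freq_le {G : Type*} [Group G]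
    {S : MapSequence G} (hS : S.IsSoficApproximation) (F : Finset G) {η : ℝ} (hη : 0 < η) :
    ∀ᶠ i in atTop, freq (goodSet (S.σ i) (F : Set G))ᶜ ≤ η := by
  obtain ⟨K, ε, hmono, hK, hε, happ⟩ := hS
  have hmono' : Monotone K := monotone_nat_of_le_succ hmono
  have hF : ∃ n, (F : Set G) ⊆ K n := by
    classical
    induction F using Finset.induction_on with
    | empty => exact ⟨0, by simp⟩
    | insert a s _ ih =>
      obtain ⟨n, hn⟩ := ih
      obtain ⟨k, hk⟩ := Set.mem_iUnion.1 (hK ▸ Set.mem_univ a : a ∈ ⋃ i, K i)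
      refine ⟨max n k, ?_⟩
      rw [Finset.coe_insert]
      exact Set.insert_subset (hmono' (le_max_right n k) hk)
        (hn.trans (hmono' (le_max_left n k)))
  obtain ⟨n, hn⟩ := hF
  filter_upwards [eventually_ge_atTop n, hε.eventually_le_const hη] with i hi hεi
  refine (freq_mono (Set.compl_subset_compl.2 (goodSet_anti _ (hn.trans (hmono' hi))))).trans ?_
  exact (freq_compl_goodSet_le (S.m_pos i) _ (happ i)).trans hεi

/-- For a sofic approximation, `σ(gh)⁻¹ = σ(h)⁻¹ σ(g)⁻¹` off a set of small frequency. -/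
theorem MapSequence.IsSoficApproximation.eventually_inv_mul {G : Type*} [Group G]
    {S : MapSequence G} (hS : S.IsSoficApproximation) (T : Finset G) {η : ℝ} (hη : 0 < η) :
    ∀ᶠ i in atTop, ∃ e : Set (Fin (S.m i)), freq e ≤ η ∧ ∀ v ∉ e, ∀ g ∈ T, ∀ h ∈ T,
      (S.σ i (g * h))⁻¹ v = (S.σ i h)⁻¹ ((S.σ i g)⁻¹ v) := by
  classical
  have hpos : 0 < η / ((T ×ˢ T).card + 1) := by positivity
  filter_upwards [hS.eventually_freq_le T hpos] with i hi
  -- Multiplicativity is needed at `σ(h)⁻¹ σ(g)⁻¹ v`, so the bad set is pushed forward by `σ(g)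
  -- σ(h)` for each of the pairs; permutations preserve its frequency.
  refine ⟨⋃ p ∈ T ×ˢ T, (S.σ i p.1 * S.σ i p.2) '' (goodSet (S.σ i) (T : Set G))ᶜ, ?_, ?_⟩
  · refine (freq_biUnion_le _ _).trans ?_
    simp only [freq_image_perm, Finset.sum_const, nsmul_eq_mul]
    calc ((T ×ˢ T).card : ℝ) * freq (goodSet (S.σ i) (T : Set G))ᶜ
        ≤ (T ×ˢ T).card * (η / ((T ×ˢ T).card + 1)) := by gcongr
      _ ≤ ((T ×ˢ T).card + 1) * (η / ((T ×ˢ T).card + 1)) := by gcongr; linarith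
      _ = η := by field_simp
  · intro v hv g hg h hh
    simp only [Set.mem_iUnion, not_exists] at hv
    have := hv (g, h) (Finset.mk_mem_product hg hh)
    have hw : (S.σ i h)⁻¹ ((S.σ i g)⁻¹ v) ∈ goodSet (S.σ i) (T : Set G) := by
      by_contra hcon
      exact this ⟨_, hcon, by simp⟩
    have := (hw g hg h hh).1
    rw [Equiv.Perm.inv_eq_iff_eq, ← this]
    simp

/-! ### Models of a coded partition -/

/-- Coordinate `g` of the coded word reads the coordinates `g * h` with `h ∈ F₁`, so windows
multiply. -/
theorem dependsOn_codeMap {G : Type*} [Group G] [DecidableEq G] {ι κ : Type*} {Z : Type*}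
    {c : (G → ι) → κ} {F₁ : Finset G} (hc : DependsOn c (F₁ : Set G)) {d : (G → κ) → Z}
    {F : Finset G} (hd : DependsOn d (F : Set G)) :
    DependsOn (fun w => d (codeMap c w)) ((F * F₁ : Finset G) : Set G) := by
  intro w w' h
  refine hd fun g hg => hc fun k hk => h _ ?_
  exact Finset.mul_mem_mul hg hk

section

variable {G : Type*} [Group G] {X : Type*} [MeasurableSpace X] [MulAction G X]
  {μ : Measure X}

theorem measureReal_exists_le [IsFiniteMeasure μ] [SMulInvariantMeasure G X μ] {P : X → Prop}
    {θ : ℝ} (h : μ.real {x | P x} ≤ θ) (F : Finset G) :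
    μ.real {x | ∃ g ∈ F, P (g⁻¹ • x)} ≤ F.card * θ := by
  have : {x | ∃ g ∈ F, P (g⁻¹ • x)} = ⋃ g ∈ F, (fun x => g⁻¹ • x) ⁻¹' {x | P x} := by
    ext x; simp
  rw [this]
  refine (measureReal_biUnion_finset_le _ _).trans ?_
  rw [← nsmul_eq_mul]
  refine Finset.sum_le_card_nsmul _ _ _ fun g _ => ?_
  rw [measureReal_def, measure_preimage_smul]
  exact h

/-- Off the exceptional set, the itinerary of the coded model is the code of the itinerary. -/
theorem modelItinerary_code {m : ℕ} {σ : G → Equiv.Perm (Fin m)} {T : Finset G}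
    {e : Set (Fin m)} (he : ∀ v ∉ e, ∀ g ∈ T, ∀ h ∈ T, (σ (g * h))⁻¹ v = (σ h)⁻¹ ((σ g)⁻¹ v))
    {ι κ : Type*} {c : (G → ι) → κ} {F₁ : Finset G} (hc : DependsOn c (F₁ : Set G))
    (hF₁ : F₁ ⊆ T) (b : Fin m → ι) {v : Fin m} (hv : v ∉ e) {g : G} (hg : g ∈ T) :
    modelItinerary σ (fun v => c (modelItinerary σ b v)) v g =
      codeMap c (modelItinerary σ b v) g := by
  refine hc fun h hh => ?_
  simp only [modelItinerary]
  rw [he v hv g hg h (hF₁ hh)]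

theorem itinerary_eq_codeMap {ι κ : Type*} {γ : OrdPartition X ι} {δ : OrdPartition X κ}
    {c : (G → ι) → κ} {F : Finset G} {x : X}
    (hx : x ∉ {x | ∃ g ∈ F, δ.label (g⁻¹ • x) ≠ c (itinerary G γ (g⁻¹ • x))}) :
    ∀ g ∈ F, itinerary G δ x g = codeMap c (itinerary G γ x) g := by
  intro g hg
  rw [codeMap_itinerary]
  by_contra hcon
  exact hx ⟨g, hg, hcon⟩

/-- In a good model of `γ` the average of a function of the label is close to its integral. -/
theorem sum_label_le [MeasurableConstSMul G X] [IsFiniteMeasure μ] {m u : ℕ}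
    {σ : G → Equiv.Perm (Fin m)} {γ : OrdPartition X (Fin u)} {η : ℝ} (hm : 0 < m) (ψ : Fin u → ℝ) {F' : Finset G} (h1 : 1 ∈ F')
    {b : Fin m → Fin u} (hb : distF μ σ F' γ b ≤ η) :
    ∑ v, ψ (b v) ≤ m * (∑ i, μ.real (γ.atom i) * ψ i + (∑ i, |ψ i|) * η) := by
  classical
  have hm' : (0 : ℝ) < m := by exact_mod_cast hm
  have key : ∀ i, |μ.real (γ.atom i) - freq (b ⁻¹' {i})| ≤ η := by
    intro i
    have h := (abs_sub_le_distF μ σ γ b (E := {w | w 1 = i}) (F := F') (by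
      intro w w' h
      have h'' : w 1 = w' 1 := h 1 h1
      simp [h''])).trans hb
    have e₁ : {x | itinerary G γ x ∈ {w : G → Fin u | w 1 = i}} = γ.atom i := by
      ext x; simp [itinerary, OrdPartition.atom]
    -- `σ 1` need not be the identity, but a permutation does not change the frequency.
    have e₂ : {v | modelItinerary σ b v ∈ {w : G → Fin u | w 1 = i}} =
        σ 1 '' (b ⁻¹' {i}) := by
      rw [Equiv.image_eq_preimage_symm]; rfl
    rwa [e₁, e₂, freq_image_perm] at h
  have hsum : ∑ v, ψ (b v) = m * ∑ i, freq (b ⁻¹' {i}) * ψ i := by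
    have : ∑ v, ψ (b v) = ∑ i, ((b ⁻¹' {i}).ncard : ℝ) * ψ i := by
      rw [← Finset.sum_fiberwise Finset.univ b]
      refine Finset.sum_congr rfl fun i _ => ?_
      have : ∀ v ∈ Finset.univ.filter (fun v => b v = i), ψ (b v) = ψ i := by
        intro v hv; rw [(Finset.mem_filter.1 hv).2]
      rw [Finset.sum_congr rfl this, Finset.sum_const, nsmul_eq_mul,
        Set.ncard_eq_toFinset_card']
      congr 3
      ext v; simp
    rw [this, Finset.mul_sum]
    refine Finset.sum_congr rfl fun i _ => ?_
    unfold freq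
    field_simp
  rw [hsum]
  refine mul_le_mul_of_nonneg_left ?_ hm'.le
  rw [Finset.sum_mul, ← Finset.sum_add_distrib]
  refine Finset.sum_le_sum fun i _ => ?_
  have h₁ : (freq (b ⁻¹' {i}) - μ.real (γ.atom i)) * ψ i ≤ η * |ψ i| := by
    refine (le_abs_self _).trans ?_
    rw [abs_mul, abs_sub_comm]
    exact mul_le_mul_of_nonneg_right (key i) (abs_nonneg _)
  linarith

variable [MeasurableConstSMul G X] [IsFiniteMeasure μ] [SMulInvariantMeasure G X μ]
  {m u k l : ℕ} {σ : G → Equiv.Perm (Fin m)}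
  {T : Finset G} {e : Set (Fin m)}
  {γ : OrdPartition X (Fin u)} {δ : OrdPartition X (Fin k)}
  {c : (G → Fin u) → Fin k} {F₁ : Finset G} {θ' η : ℝ}

/-- A good model of `γ` is coded to a good model of a partition close to the code of `γ`. -/
theorem distF_code_le
    (he : ∀ v ∉ e, ∀ g ∈ T, ∀ h ∈ T, (σ (g * h))⁻¹ v = (σ h)⁻¹ ((σ g)⁻¹ v)) (heη : freq e ≤ η)
    (hc : DependsOn c (F₁ : Set G)) (hF₁ : F₁ ⊆ T) {F : Finset G} (hF : F ⊆ T)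
    (hcδ : μ.real {x | δ.label x ≠ c (itinerary G γ x)} ≤ θ') {F' : Finset G}
    [DecidableEq G] (hF' : F * F₁ ⊆ F') {b : Fin m → Fin u} (hb : distF μ σ F' γ b ≤ η) :
    distF μ σ F δ (fun v => c (modelItinerary σ b v)) ≤ 2 * (F.card * θ' + 2 * η) := by
  refine distF_le_of_events μ σ δ _ fun E hE => ?_
  set E' : Set (G → Fin u) := {w | codeMap c w ∈ E}
  have hE' : DependsOn (fun w => w ∈ E') (F' : Set G) :=
    (dependsOn_codeMap hc hE).mono (by exact_mod_cast hF')
  have h₁ : |μ.real {x | itinerary G δ x ∈ E} - μ.real {x | itinerary G γ x ∈ E'}| ≤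
      F.card * θ' := by
    refine (measureReal_abs_sub_le μ
      (e := {x | ∃ g ∈ F, δ.label (g⁻¹ • x) ≠ c (itinerary G γ (g⁻¹ • x))}) ?_).trans
      (measureReal_exists_le hcδ F)
    intro x hx
    exact iff_of_eq (hE (itinerary_eq_codeMap hx))
  have h₂ : |freq {v | modelItinerary σ b v ∈ E'} -
      freq {v | modelItinerary σ (fun v => c (modelItinerary σ b v)) v ∈ E}| ≤ η := by
    refine (freq_abs_sub_le (e := e) fun v hv => ?_).trans heη
    refine iff_of_eq (hE (x := codeMap c (modelItinerary σ b v)) fun g hg => ?_)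
    exact (modelItinerary_code he hc hF₁ b hv (hF hg)).symm
  have h₃ := (abs_sub_le_distF μ σ γ b hE').trans hb
  have := abs_sub_le (μ.real {x | itinerary G δ x ∈ E}) (μ.real {x | itinerary G γ x ∈ E'})
    (freq {v | modelItinerary σ (fun v => c (modelItinerary σ b v)) v ∈ E})
  have := abs_sub_le (μ.real {x | itinerary G γ x ∈ E'}) (freq {v | modelItinerary σ b v ∈ E'})
    (freq {v | modelItinerary σ (fun v => c (modelItinerary σ b v)) v ∈ E})
  linarith

/-- If a coarsening of `γ` is almost a code of `δ` and `δ` almost a code of `γ`, then the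
coarsening of a good model of `γ` is almost determined by the corresponding model of `δ`. -/
theorem freq_decode_le
    (he : ∀ v ∉ e, ∀ g ∈ T, ∀ h ∈ T, (σ (g * h))⁻¹ v = (σ h)⁻¹ ((σ g)⁻¹ v)) (heη : freq e ≤ η)
    (hc : DependsOn c (F₁ : Set G)) (hF₁ : F₁ ⊆ T) {F₂ : Finset G} (hF₂ : F₂ ⊆ T) (h1T : 1 ∈ T)
    (hcδ : μ.real {x | δ.label x ≠ c (itinerary G γ x)} ≤ θ')
    {π : Fin u → Fin l} {d : (G → Fin k) → Fin l} (hd : DependsOn d (F₂ : Set G)) {θ : ℝ}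
    (hdγ : μ.real {x | π (γ.label x) ≠ d (itinerary G δ x)} ≤ θ) {F' : Finset G}
    [DecidableEq G] (hF' : F₂ * F₁ ⊆ F') (h1 : 1 ∈ F') {b : Fin m → Fin u}
    (hb : distF μ σ F' γ b ≤ η) :
    freq {v | π (b v) ≠ d (modelItinerary σ (fun v => c (modelItinerary σ b v)) v)} ≤
      θ + F₂.card * θ' + 2 * η := by
  -- Failure of decoding is a finite-window event for `γ`: it is rare in `X`, hence rare in a good
  -- model.
  set E : Set (G → Fin u) := {w | π (w 1) ≠ d (codeMap c w)}
  have hE : DependsOn (fun w => w ∈ E) (F' : Set G) := by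
    intro w w' h
    have h' := (dependsOn_codeMap hc hd).mono (t := (F' : Set G)) (by exact_mod_cast hF') h
    have h'' : w 1 = w' 1 := h 1 h1
    simp only [E, Set.mem_ofPred_eq]
    rw [h', h'']
  have h₁ : μ.real {x | itinerary G γ x ∈ E} ≤ θ + F₂.card * θ' := by
    refine (measureReal_mono (s₂ := {x | π (γ.label x) ≠ d (itinerary G δ x)} ∪
      {x | ∃ g ∈ F₂, δ.label (g⁻¹ • x) ≠ c (itinerary G γ (g⁻¹ • x))}) ?_).trans
      ((measureReal_union_le _ _).trans (add_le_add hdγ (measureReal_exists_le hcδ F₂)))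
    intro x hx
    by_cases hx' : x ∈ {x | ∃ g ∈ F₂, δ.label (g⁻¹ • x) ≠ c (itinerary G γ (g⁻¹ • x))}
    · exact Or.inr hx'
    · refine Or.inl ?_
      have h : d (itinerary G δ x) = d (codeMap c (itinerary G γ x)) :=
        hd (itinerary_eq_codeMap hx')
      have hx1 : π (itinerary G γ x 1) ≠ d (codeMap c (itinerary G γ x)) := hx
      simp only [Set.mem_ofPred_eq, h]
      simpa [itinerary] using hx1
  have h₂ : |freq {v | modelItinerary σ b v ∈ E} -
      freq {v | π (b v) ≠ d (modelItinerary σ (fun v => c (modelItinerary σ b v)) v)}| ≤ η := by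
    refine (freq_abs_sub_le (e := e) fun v hv => ?_).trans heη
    have h : d (modelItinerary σ (fun v => c (modelItinerary σ b v)) v) =
        d (codeMap c (modelItinerary σ b v)) :=
      hd fun g hg => modelItinerary_code he hc hF₁ b hv (hF₂ hg)
    -- Off `e` the relation for `1 * 1` forces `σ 1` to fix `v`.
    have h1v : modelItinerary σ b v 1 = b v := by
      have := he v hv 1 h1T 1 h1T
      rw [mul_one] at this
      have := (σ 1)⁻¹.injective this
      simp only [modelItinerary]
      rw [← this]
    simp only [E, Set.mem_ofPred_eq, h, h1v]
  have h₃ := (abs_sub_le_distF μ σ γ b hE).trans hb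
  rw [abs_le] at h₂ h₃
  linarith

end

/-! ### Comparing the entropies of two partitions that code each other -/

theorem ncard_le_mul_of_mapsTo {A B : Type*} [Finite A] [Finite B] {s : Set A} {t : Set B}
    (f : A → B) (hf : Set.MapsTo f s t) {M : ℝ} (h : ∀ y ∈ t, ((s ∩ f ⁻¹' {y}).ncard : ℝ) ≤ M) :
    (s.ncard : ℝ) ≤ t.ncard * M := by
  classical
  have := Fintype.ofFinite A
  have := Fintype.ofFinite B
  rw [Set.ncard_eq_toFinset_card', Set.ncard_eq_toFinset_card' t,
    Finset.card_eq_sum_card_fiberwise (f := f) (s := s.toFinset) (t := t.toFinset)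
      (by intro a ha; simpa using hf (by simpa using ha)), Nat.cast_sum, ← nsmul_eq_mul]
  refine Finset.sum_le_card_nsmul _ _ _ fun y hy => ?_
  refine le_trans (le_of_eq ?_) (h y (by simpa using hy))
  rw [Set.ncard_eq_toFinset_card']
  congr 2
  ext a; simp

/-- Labels over the predicted coarse label `j` keep their weight; the others are damped by `t`, so
all `l` fibres together add only `t * (l * (1 + s))`. -/
theorem sum_ite_weight_le {u l : ℕ} (π : Fin u → Fin l) (w : Fin u → ℝ) {s t : ℝ}
    (hw : ∀ i, 0 < w i) (hws : ∀ j, ∑ i with π i = j, w i ≤ 1 + s) (ht0 : 0 < t) (j : Fin l) :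
    ∑ i, (if π i = j then w i else t * w i) ≤ Real.exp (s + t * (l * (1 + s))) := by
  have hall : ∑ i, w i ≤ l * (1 + s) := by
    rw [← Finset.sum_fiberwise Finset.univ π]
    have := Finset.sum_le_card_nsmul Finset.univ _ (1 + s) fun j _ => hws j
    rwa [Finset.card_univ, Fintype.card_fin, nsmul_eq_mul] at this
  calc ∑ i, (if π i = j then w i else t * w i)
      ≤ ∑ i, ((if π i = j then w i else 0) + t * w i) := by
        refine Finset.sum_le_sum fun i _ => ?_
        have := mul_pos ht0 (hw i)
        split_ifs <;> linarith
    _ = (∑ i with π i = j, w i) + t * ∑ i, w i := by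
        rw [Finset.sum_add_distrib, Finset.sum_filter, Finset.mul_sum]
    _ ≤ (1 + s) + t * (l * (1 + s)) := by
        gcongr
        exact hws j
    _ ≤ Real.exp (s + t * (l * (1 + s))) := by
        have := Real.add_one_le_exp (s + t * (l * (1 + s)))
        linarith

/-- Logarithms are taken in the extended reals, so empty sets of models, with value `-∞`, need no
separate case. -/
theorem limsup_log_div_le {G : Type*} {S : MapSequence G} {a b : ℕ → ℕ} {B : ℝ}
    (h : ∀ᶠ i in atTop, (a i : ℝ) ≤ b i * Real.exp (S.m i * B)) :
    limsup (fun i => ENNReal.log (a i : ℝ≥0∞) / (S.m i : EReal)) atTop ≤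
      limsup (fun i => ENNReal.log (b i : ℝ≥0∞) / (S.m i : EReal)) atTop + (B : EReal) := by
  have h' : ∀ᶠ i in atTop, ENNReal.log (a i : ℝ≥0∞) / (S.m i : EReal) ≤
      ENNReal.log (b i : ℝ≥0∞) / (S.m i : EReal) + (B : EReal) := by
    filter_upwards [h] with i hi
    have hm : (0 : ℝ) < S.m i := by exact_mod_cast S.m_pos i
    have h₁ : (a i : ℝ≥0∞) ≤ b i * ENNReal.ofReal (Real.exp (S.m i * B)) := by
      have := ENNReal.ofReal_le_ofReal hi
      rwa [ENNReal.ofReal_mul (by positivity), ENNReal.ofReal_natCast,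
        ENNReal.ofReal_natCast] at this
    have h₂ := ENNReal.log_monotone h₁
    rw [ENNReal.log_mul_add, ENNReal.log_ofReal, if_neg (not_le.2 (Real.exp_pos _)),
      Real.log_exp] at h₂
    have hm0 : (0 : EReal) ≤ (S.m i : EReal) := by exact_mod_cast Nat.zero_le _
    refine (EReal.div_le_div_right_of_nonneg hm0 h₂).trans ?_
    rw [EReal.add_div_of_nonneg_right hm0]
    refine add_le_add le_rfl (le_of_eq ?_)
    have : ((S.m i : ℕ) : EReal) = ((S.m i : ℝ) : EReal) := by simp
    rw [this, ← EReal.coe_div]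
    congr 1
    field_simp
  refine (limsup_le_limsup h').trans ?_
  refine (EReal.limsup_add_le (v := fun _ => (B : EReal)) (Or.inr ?_) (Or.inr ?_)).trans ?_
  · simp
  · simp
  · simp

section

variable {G : Type*} [Group G] {X : Type*} [MeasurableSpace X] [MulAction G X]
  [MeasurableConstSMul G X] {μ : Measure X} [IsFiniteMeasure μ] [SMulInvariantMeasure G X μ]
  {u k l : ℕ} {γ : OrdPartition X (Fin u)} {δ : OrdPartition X (Fin k)}
  {c : (G → Fin u) → Fin k} {F₁ : Finset G} {θ' θ s t : ℝ}
  {π : Fin u → Fin l} {w : Fin u → ℝ} {d : (G → Fin k) → Fin l} {F₂ : Finset G}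

/-- Models of `γ` are mapped to models of `δ` by `c`, and each fibre is counted with weights. In the
window, `F * F₁` controls the coded model on `F`, `F₂ * F₁` the decoding by `d`, and `1` the label
itself. -/
theorem ncard_approxPartitions_le [DecidableEq G] {m : ℕ} {σ : G → Equiv.Perm (Fin m)}
    {T : Finset G} {e : Set (Fin m)} {η : ℝ} (hm : 0 < m)
    (he : ∀ v ∉ e, ∀ g ∈ T, ∀ h ∈ T, (σ (g * h))⁻¹ v = (σ h)⁻¹ ((σ g)⁻¹ v)) (heη : freq e ≤ η)
    {F : Finset G} (hFT : insert 1 (F ∪ F₁ ∪ F₂) ⊆ T)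
    (hw : ∀ i, 0 < w i) (hws : ∀ j, ∑ i with π i = j, w i ≤ 1 + s)
    (hc : DependsOn c (F₁ : Set G)) (hd : DependsOn d (F₂ : Set G))
    (hcδ : μ.real {x | δ.label x ≠ c (itinerary G γ x)} ≤ θ')
    (hdγ : μ.real {x | π (γ.label x) ≠ d (itinerary G δ x)} ≤ θ)
    (ht0 : 0 < t) (ht1 : t ≤ 1) :
    ((approxPartitions μ σ γ (insert 1 (F * F₁ ∪ F₂ * F₁)) η).ncard : ℝ) ≤
      (approxPartitions μ σ δ F (2 * (F.card * θ' + 2 * η))).ncard *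
        Real.exp (m * (s + t * (l * (1 + s)) +
          (∑ i, μ.real (γ.atom i) * -Real.log (w i) + (∑ i, |-Real.log (w i)|) * η) +
          (θ + F₂.card * θ' + 2 * η) * -Real.log t)) := by
  have h1T : 1 ∈ T := hFT (Finset.mem_insert_self _ _)
  have hF : F ⊆ T := fun g hg => hFT (by simp [hg])
  have hF₁ : F₁ ⊆ T := fun g hg => hFT (by simp [hg])
  have hF₂ : F₂ ⊆ T := fun g hg => hFT (by simp [hg])
  set F' : Finset G := insert 1 (F * F₁ ∪ F₂ * F₁) with hF'
  have h1 : 1 ∈ F' := Finset.mem_insert_self _ _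
  have hFF' : F * F₁ ⊆ F' := fun g hg => by rw [hF', Finset.mem_insert, Finset.mem_union]; tauto
  have hF₂F' : F₂ * F₁ ⊆ F' := fun g hg => by
    rw [hF', Finset.mem_insert, Finset.mem_union]; tauto
  refine ncard_le_mul_of_mapsTo (fun b v => c (modelItinerary σ b v)) (fun b hb => ?_)
    fun b' _ => ?_
  · exact distF_code_le he heη hc hF₁ hF hcδ hFF' hb
  · have hlt : 0 ≤ -Real.log t := by
      have := Real.log_nonpos ht0.le ht1
      linarith
    refine (ncard_le_of_weights
      (fun v i => if π i = d (modelItinerary σ b' v) then w i else t * w i) ?_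
      (fun v => sum_ite_weight_le π w hw hws ht0 _) _
      (K := m * ((∑ i, μ.real (γ.atom i) * -Real.log (w i) + (∑ i, |-Real.log (w i)|) * η) +
          (θ + F₂.card * θ' + 2 * η) * -Real.log t)) ?_).trans (le_of_eq ?_)
    · intro v i
      split_ifs
      · exact hw i
      · exact mul_pos ht0 (hw i)
    · rintro b ⟨hb, hbb'⟩
      have hbb' : (fun v => c (modelItinerary σ b v)) = b' := hbb'
      have h₁ := sum_label_le hm (fun i => -Real.log (w i)) h1 hb
      have h₂ := freq_decode_le he heη hc hF₁ hF₂ h1T hcδ hd hdγ hF₂F' h1 hb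
      rw [hbb'] at h₂
      set D := {v | π (b v) ≠ d (modelItinerary σ b' v)} with hD
      have hm' : (0 : ℝ) < m := by exact_mod_cast hm
      have h₃ : (D.ncard : ℝ) ≤ m * (θ + F₂.card * θ' + 2 * η) := by
        unfold freq at h₂
        rw [div_le_iff₀ hm'] at h₂
        linarith
      classical
      -- Each wrongly predicted point costs an extra `-log t`, and `h₃` bounds their number.
      have h₄ : ∑ v, -Real.log (if π (b v) = d (modelItinerary σ b' v) then w (b v)
          else t * w (b v)) = ∑ v, -Real.log (w (b v)) + D.ncard * -Real.log t := by
        have : (D.ncard : ℝ) * -Real.log t = ∑ v, if v ∈ D then -Real.log t else 0 := by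
          rw [← Finset.sum_filter, Finset.sum_const, nsmul_eq_mul, Set.ncard_eq_toFinset_card']
          congr 3
          ext v; simp
        rw [this, ← Finset.sum_add_distrib]
        refine Finset.sum_congr rfl fun v _ => ?_
        by_cases hv : π (b v) = d (modelItinerary σ b' v)
        · rw [if_pos hv, if_neg (fun h : v ∈ D => h hv)]; ring
        · rw [if_neg hv, if_pos (show v ∈ D from hv), Real.log_mul ht0.ne' (hw _).ne']; ring
      rw [h₄]
      have := mul_le_mul_of_nonneg_right h₃ hlt
      linarith
    · congr 1
      ring

/-- If `δ` is almost a code of `γ` and a coarsening of `γ` almost a code of `δ`, then the entropy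
of `γ` exceeds that of `δ` at most by the weight cost of recovering `γ` from its coarsening. -/
theorem entropyFin_le_of_codes [DecidableEq G] {S : MapSequence G} (hS : S.IsSoficApproximation)
    (hw : ∀ i, 0 < w i) (hws : ∀ j, ∑ i with π i = j, w i ≤ 1 + s)
    (hc : DependsOn c (F₁ : Set G)) (hd : DependsOn d (F₂ : Set G))
    (hcδ : μ.real {x | δ.label x ≠ c (itinerary G γ x)} ≤ θ')
    (hdγ : μ.real {x | π (γ.label x) ≠ d (itinerary G δ x)} ≤ θ)
    (ht0 : 0 < t) (ht1 : t ≤ 1) {F : Finset G} {ε₀ B : ℝ} (hε₀ : 2 * (F.card * θ') < ε₀)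
    (hB : s + t * (l * (1 + s)) + ∑ i, μ.real (γ.atom i) * -Real.log (w i) +
      (θ + F₂.card * θ') * -Real.log t < B) :
    entropyFin S μ γ (insert 1 (F * F₁ ∪ F₂ * F₁)) ≤ entropyFinEps S μ δ F ε₀ + (B : EReal) := by
  have hlt : 0 ≤ -Real.log t := by
    have := Real.log_nonpos ht0.le ht1
    linarith
  set C := ∑ i, |-Real.log (w i)| with hC
  have hC0 : 0 ≤ C := Finset.sum_nonneg fun _ _ => abs_nonneg _
  set Q := s + t * (l * (1 + s)) + ∑ i, μ.real (γ.atom i) * -Real.log (w i) +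
      (θ + F₂.card * θ') * -Real.log t with hQ
  -- The strict inequalities `hε₀` and `hB` leave room for the model tolerance `η`; one entry of the
  -- minimum serves each of them.
  obtain ⟨η, hη, h₁, h₂⟩ : ∃ η : ℝ, 0 < η ∧ 2 * (F.card * θ' + 2 * η) ≤ ε₀ ∧
      Q + (C + 2 * -Real.log t) * η ≤ B := by
    refine ⟨min ((ε₀ - 2 * (F.card * θ')) / 4) ((B - Q) / (C + 2 * -Real.log t + 1)),
      lt_min (by linarith) (div_pos (by linarith) (by linarith)), ?_, ?_⟩
    · have := min_le_left ((ε₀ - 2 * (F.card * θ')) / 4) ((B - Q) / (C + 2 * -Real.log t + 1))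
      linarith
    · set D := C + 2 * -Real.log t
      have hD : 0 ≤ D := by positivity
      have : D * min ((ε₀ - 2 * (F.card * θ')) / 4) ((B - Q) / (D + 1)) ≤ B - Q := by
        calc _ ≤ D * ((B - Q) / (D + 1)) := by gcongr; exact min_le_right _ _
          _ ≤ (D + 1) * ((B - Q) / (D + 1)) := by
              refine mul_le_mul_of_nonneg_right (by linarith) ?_
              exact div_nonneg (by linarith) (by linarith)
          _ = B - Q := by field_simp
      linarith
  refine (iInf_le _ ⟨η, hη⟩).trans ?_
  refine limsup_log_div_le ?_
  filter_upwards [hS.eventually_inv_mul (insert 1 (F ∪ F₁ ∪ F₂)) hη] with i ⟨e, heη, he⟩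
  refine (ncard_approxPartitions_le (S.m_pos i) he heη subset_rfl hw hws hc hd hcδ hdγ
    ht0 ht1).trans ?_
  have hsub : approxPartitions μ (S.σ i) δ F (2 * (F.card * θ' + 2 * η)) ⊆
      approxPartitions μ (S.σ i) δ F ε₀ := fun b hb => le_trans hb h₁
  have := Set.ncard_le_ncard hsub (Set.toFinite _)
  gcongr
  linarith

end

/-! ### Refinement and chains -/

theorem Refines.exists_map {X : Type*} [MeasurableSpace X] {μ : Measure X} {ι κ : Type*}
    [Countable ι] {a : X → ι} {b : X → κ} (h : Refines μ a b) :
    ∃ ρ : ι → κ, ∀ᵐ x ∂μ, b x = ρ (a x) := by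
  choose ρ hρ using h
  refine ⟨ρ, ?_⟩
  rw [ae_iff]
  refine measure_mono_null (fun x hx => ?_) (measure_iUnion_null hρ)
  exact Set.mem_iUnion.2 ⟨a x, rfl, hx⟩

theorem refines_of_comp {X : Type*} [MeasurableSpace X] (μ : Measure X) {ι κ : Type*}
    [Nonempty κ] {a : X → ι} {b : X → κ} (h : ∀ x y, a x = a y → b x = b y) :
    Refines μ a b := by
  intro i
  by_cases hi : ∃ x, a x = i
  · obtain ⟨x, rfl⟩ := hi
    refine ⟨b x, ?_⟩
    have : a ⁻¹' {a x} \ b ⁻¹' {b x} = ∅ := by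
      rw [Set.sdiff_eq_empty]
      exact fun y hy => h y x hy
    rw [this, measure_empty]
  · refine ⟨Classical.arbitrary κ, ?_⟩
    have : a ⁻¹' {i} = ∅ := Set.eq_empty_of_forall_notMem fun x hx => hi ⟨x, hx⟩
    rw [this, Set.empty_sdiff, measure_empty]

theorem IsChain.exists_map {X : Type*} [MeasurableSpace X] {μ : Measure X}
    {α : OrdPartition X ℕ} {u : ℕ → ℕ} {γ : ∀ n, OrdPartition X (Fin (u n))}
    (h : IsChain μ α u γ) {n k : ℕ} (hnk : n ≤ k) :
    ∃ ρ : Fin (u k) → Fin (u n), ∀ᵐ x ∂μ, (γ n).label x = ρ ((γ k).label x) := by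
  induction k, hnk using Nat.le_induction with
  | base => exact ⟨id, Eventually.of_forall fun _ => rfl⟩
  | succ k _ ih =>
    obtain ⟨ρ, hρ⟩ := ih
    obtain ⟨τ, hτ⟩ := (h.mono k).exists_map
    refine ⟨ρ ∘ τ, ?_⟩
    filter_upwards [hρ, hτ] with x h₁ h₂
    rw [h₁, h₂]; rfl

/-! ### Sets approximated by finite blocks of a sequence of partitions -/

section

variable {G : Type*} [Group G] {X : Type*} [MeasurableSpace X] [MulAction G X]

/-- `A` can be approximated by events that depend on finitely many coordinates of the itinerary
with respect to `γ n`, with a window that works for all large `n`. -/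
def Approximable (G : Type*) [Group G] {X : Type*} [MeasurableSpace X] [MulAction G X]
    (μ : Measure X) {u : ℕ → ℕ} (γ : ∀ n, OrdPartition X (Fin (u n))) (A : Set X) : Prop :=
  ∀ θ : ℝ, 0 < θ → ∃ (n₀ : ℕ) (F : Finset G), ∀ n ≥ n₀, ∃ E : Set (G → Fin (u n)),
    DependsOn (fun w => w ∈ E) (F : Set G) ∧
      μ.real (symmDiff A {x | itinerary G (γ n) x ∈ E}) ≤ θ

variable {μ : Measure X} {u : ℕ → ℕ} {γ : ∀ n, OrdPartition X (Fin (u n))}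

theorem approximable_empty : Approximable G μ γ ∅ :=
  fun θ hθ => ⟨0, ∅, fun _ _ => ⟨∅, fun _ _ _ => rfl, by simp [hθ.le]⟩⟩

theorem Approximable.compl {A : Set X} (h : Approximable G μ γ A) : Approximable G μ γ Aᶜ := by
  intro θ hθ
  obtain ⟨n₀, F, hF⟩ := h θ hθ
  refine ⟨n₀, F, fun n hn => ?_⟩
  obtain ⟨E, hE, hμ⟩ := hF n hn
  refine ⟨Eᶜ, fun w w' hw => ?_, ?_⟩
  · exact congrArg Not (hE hw)
  · have : {x | itinerary G (γ n) x ∈ Eᶜ} = {x | itinerary G (γ n) x ∈ E}ᶜ := rfl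
    rwa [this, compl_symmDiff_compl]

theorem Approximable.union [IsFiniteMeasure μ] {A B : Set X} (hA : Approximable G μ γ A)
    (hB : Approximable G μ γ B) : Approximable G μ γ (A ∪ B) := by
  classical
  intro θ hθ
  obtain ⟨n₁, F₁, h₁⟩ := hA (θ / 2) (half_pos hθ)
  obtain ⟨n₂, F₂, h₂⟩ := hB (θ / 2) (half_pos hθ)
  refine ⟨max n₁ n₂, F₁ ∪ F₂, fun n hn => ?_⟩
  obtain ⟨E₁, hE₁, hμ₁⟩ := h₁ n (le_of_max_le_left hn)
  obtain ⟨E₂, hE₂, hμ₂⟩ := h₂ n (le_of_max_le_right hn)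
  refine ⟨E₁ ∪ E₂, fun w w' hw => ?_, ?_⟩
  · exact congrArg₂ Or (hE₁ fun g hg => hw g (by simp [Finset.mem_coe.1 hg]))
      (hE₂ fun g hg => hw g (by simp [Finset.mem_coe.1 hg]))
  · have : {x | itinerary G (γ n) x ∈ E₁ ∪ E₂} =
        {x | itinerary G (γ n) x ∈ E₁} ∪ {x | itinerary G (γ n) x ∈ E₂} := rfl
    rw [this]
    refine (measureReal_mono (s₂ := symmDiff A {x | itinerary G (γ n) x ∈ E₁} ∪
      symmDiff B {x | itinerary G (γ n) x ∈ E₂}) ?_).trans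
      ((measureReal_union_le _ _).trans (by linarith))
    intro x
    simp only [Set.mem_symmDiff, Set.mem_union]
    tauto

theorem Approximable.of_forall_close [IsFiniteMeasure μ] {A : Set X}
    (h : ∀ θ : ℝ, 0 < θ → ∃ B, Approximable G μ γ B ∧ μ.real (symmDiff A B) ≤ θ) :
    Approximable G μ γ A := by
  intro θ hθ
  obtain ⟨B, hB, hAB⟩ := h (θ / 2) (half_pos hθ)
  obtain ⟨n₀, F, hF⟩ := hB (θ / 2) (half_pos hθ)
  refine ⟨n₀, F, fun n hn => ?_⟩
  obtain ⟨E, hE, hμ⟩ := hF n hn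
  refine ⟨E, hE, (measureReal_mono (symmDiff_triangle A B _)).trans
    ((measureReal_union_le _ _).trans (by linarith))⟩

theorem Approximable.of_null [IsFiniteMeasure μ] {A B : Set X} (hB : Approximable G μ γ B)
    (h : μ (symmDiff A B) = 0) : Approximable G μ γ A :=
  Approximable.of_forall_close fun θ hθ => ⟨B, hB, by simp [measureReal_def, h, hθ.le]⟩

/-- Translating the set translates the window, which stays independent of `n`. -/
theorem Approximable.smul [SMulInvariantMeasure G X μ] {A : Set X} (hA : Approximable G μ γ A)
    (g : G) : Approximable G μ γ (g • A) := by
  classical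
  intro θ hθ
  obtain ⟨n₀, F, hF⟩ := hA θ hθ
  refine ⟨n₀, F.image (g * ·), fun n hn => ?_⟩
  obtain ⟨E, hE, hμ⟩ := hF n hn
  refine ⟨{w | (fun h => w (g * h)) ∈ E}, fun w w' hw => hE fun h hh => hw _ ?_, ?_⟩
  · exact Finset.mem_coe.2 (Finset.mem_image_of_mem _ hh)
  · have : {x | itinerary G (γ n) x ∈ {w | (fun h => w (g * h)) ∈ E}} =
        g • {x | itinerary G (γ n) x ∈ E} := by
      ext x
      rw [Set.mem_smul_set_iff_inv_smul_mem, Set.mem_ofPred_eq]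
      change _ ↔ itinerary G (γ n) (g⁻¹ • x) ∈ E
      rw [itinerary_inv_smul]
      rfl
    rw [this, ← Set.smul_set_symmDiff, measureReal_def, measure_smul]
    exact hμ

theorem Approximable.iUnion [IsFiniteMeasure μ] {A : ℕ → Set X} (hm : ∀ n, MeasurableSet (A n))
    (h : ∀ n, Approximable G μ γ (A n)) : Approximable G μ γ (⋃ n, A n) := by
  have hacc : ∀ n, Approximable G μ γ (Set.accumulate A n) := by
    intro n
    induction n with
    | zero => simpa using h 0
    | succ n ih => rw [Set.accumulate_succ]; exact ih.union (h _)
  have hlim : Tendsto (fun n => μ.real (Set.accumulate A n)) atTop (𝓝 (μ.real (⋃ n, A n))) :=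
    (ENNReal.tendsto_toReal (measure_ne_top _ _)).comp tendsto_measure_iUnion_accumulate
  refine Approximable.of_forall_close fun θ hθ => ?_
  obtain ⟨n, hn⟩ := (hlim.eventually (lt_mem_nhds (sub_lt_self _ hθ))).exists
  refine ⟨_, hacc n, ?_⟩
  have hsub : Set.accumulate A n ⊆ ⋃ n, A n := Set.accumulate_subset_iUnion n
  rw [Set.symmDiff_def, Set.sdiff_eq_empty.2 hsub, Set.union_empty,
    measureReal_sdiff hsub (MeasurableSet.biUnion (Set.to_countable _) fun k _ => hm k)]
  linarith

/-- The σ-algebra of measurable approximable sets. -/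
@[reducible]
def approximableSpace (G : Type*) [Group G] {X : Type*} [MeasurableSpace X] [MulAction G X]
    (μ : Measure X) [IsFiniteMeasure μ] {u : ℕ → ℕ} (γ : ∀ n, OrdPartition X (Fin (u n))) :
    MeasurableSpace X where
  MeasurableSet' A := MeasurableSet A ∧ Approximable G μ γ A
  measurableSet_empty := ⟨MeasurableSet.empty, approximable_empty⟩
  measurableSet_compl _ h := ⟨h.1.compl, h.2.compl⟩
  measurableSet_iUnion _ h :=
    ⟨MeasurableSet.iUnion fun n => (h n).1, Approximable.iUnion (fun n => (h n).1) fun n => (h n).2⟩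

theorem Approximable.iInter [IsFiniteMeasure μ] {A : ℕ → Set X} (hm : ∀ n, MeasurableSet (A n))
    (h : ∀ n, Approximable G μ γ (A n)) : Approximable G μ γ (⋂ n, A n) := by
  rw [← compl_compl (⋂ n, A n), Set.compl_iInter]
  exact (Approximable.iUnion (fun n => (hm n).compl) fun n => (h n).compl).compl

variable {α : OrdPartition X ℕ}

/-- For `k ≥ n` the partition `γ n` is almost everywhere a function of `γ k`, so the window `{1}`
serves every later stage. -/
theorem IsChain.approximable_fiber [IsFiniteMeasure μ] [SMulInvariantMeasure G X μ]
    (hγ : IsChain μ α u γ) (n : ℕ) (j : Fin (u n)) :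
    Approximable G μ γ ((γ n).label ⁻¹' {j}) := by
  intro θ hθ
  refine ⟨n, {1}, fun k hk => ?_⟩
  obtain ⟨ρ, hρ⟩ := hγ.exists_map hk
  refine ⟨{w | ρ (w 1) = j}, fun w w' hw => ?_, ?_⟩
  · have : w 1 = w' 1 := hw 1 (by simp)
    simp [this]
  · rw [measureReal_def, measure_mono_null ?_ (ae_iff.1 hρ)]
    · simpa using hθ.le
    · intro x hx
      by_contra hcon
      have hx' : (γ n).label x = ρ ((γ k).label x) := not_not.1 hcon
      simp [Set.mem_symmDiff, itinerary, ← hx'] at hx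

/-- A non-null atom lies, up to a null set, in one fibre of the join, and that fibre lies in one
atom of `α`, necessarily the same one. Thus the atom is a countable intersection of chain atoms
modulo null sets. The join may have uncountably many fibres, hence the argument one atom at a time.
-/
theorem IsChain.approximable_atom [IsFiniteMeasure μ] [SMulInvariantMeasure G X μ]
    (hγ : IsChain μ α u γ) (i : ℕ) : Approximable G μ γ (α.atom i) := by
  by_cases hi : μ (α.atom i) = 0
  · exact approximable_empty.of_null (by simpa [symmDiff_def] using hi)
  choose j hj using fun n => hγ.le n i
  obtain ⟨i', hi'⟩ := hγ.join j
  have hfib : (fun x n => (γ n).label x) ⁻¹' {j} = ⋂ n, (γ n).label ⁻¹' {j n} := by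
    ext x; simp [funext_iff]
  rw [hfib] at hi'
  have hsub : μ (α.atom i \ ⋂ n, (γ n).label ⁻¹' {j n}) = 0 := by
    rw [Set.sdiff_iInter]
    exact measure_iUnion_null hj
  have hii : i' = i := by
    by_contra hne
    refine hi (measure_mono_null (fun x hx => ?_) (measure_union_null hsub hi'))
    by_cases hx' : x ∈ ⋂ n, (γ n).label ⁻¹' {j n}
    · refine Or.inr ⟨hx', fun h => hne ?_⟩
      exact (show α.label x = i' from h).symm.trans hx
    · exact Or.inl ⟨hx, hx'⟩
  subst hii
  refine (Approximable.iInter (fun n => (γ n).measurableSet_fiber (j n))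
    fun n => hγ.approximable_fiber n (j n)).of_null ?_
  rw [symmDiff_def]
  exact measure_union_null hsub hi'

/-- The measurable approximable sets form a `G`-invariant σ-algebra containing the atoms of `α`,
hence they contain `invariantSigma`. -/
theorem IsChain.approximable_of_isGenerating [MeasurableConstSMul G X] [IsFiniteMeasure μ]
    [SMulInvariantMeasure G X μ] (hγ : IsChain μ α u γ) (hα : IsGenerating G μ α) {A : Set X}
    (hA : MeasurableSet A) : Approximable G μ γ A := by
  obtain ⟨A', hA', h0⟩ := hα A hA
  have : MeasurableSet[approximableSpace G μ γ] A' := by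
    refine MeasurableSpace.measurableSet_sInf.1 hA' _ ⟨fun g s hs => ?_, fun i => ?_⟩
    · exact ⟨hs.1.const_smul g, hs.2.smul g⟩
    · exact ⟨α.measurableSet_fiber i, hγ.approximable_atom i⟩
  exact this.2.of_null h0

/-- A finite partition into approximable sets is almost a block code. -/
theorem exists_code_of_approximable [IsFiniteMeasure μ] {k : ℕ} [NeZero k]
    (δ : OrdPartition X (Fin k)) (h : ∀ j, Approximable G μ γ (δ.atom j)) {θ : ℝ} (hθ : 0 < θ) :
    ∃ (n₀ : ℕ) (F : Finset G), ∀ n ≥ n₀, ∃ c : (G → Fin (u n)) → Fin k,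
      DependsOn c (F : Set G) ∧ μ.real {x | δ.label x ≠ c (itinerary G (γ n) x)} ≤ θ := by
  classical
  have hk : (0 : ℝ) < k := by exact_mod_cast Nat.pos_of_ne_zero (NeZero.ne k)
  choose n₀ F hF using fun j => h j (θ / k) (div_pos hθ hk)
  refine ⟨Finset.univ.sup n₀, Finset.univ.biUnion F, fun n hn => ?_⟩
  choose E hE hμ using fun j => hF j n ((Finset.le_sup (Finset.mem_univ j)).trans hn)
  -- Off the symmetric differences the itinerary lies in `E j` for the true label `j` only, so both
  -- the choice and the default `0` are harmless.
  refine ⟨fun w => if h : ∃ j, w ∈ E j then h.choose else 0, fun w w' hw => ?_, ?_⟩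
  · have : ∀ j, (w ∈ E j) = (w' ∈ E j) := fun j => hE j fun g hg =>
      hw g (by simpa using ⟨j, hg⟩)
    simp only [this]
  · refine (measureReal_mono (s₂ := ⋃ j ∈ Finset.univ,
      symmDiff (δ.atom j) {x | itinerary G (γ n) x ∈ E j}) ?_ (measure_ne_top _ _)).trans
      ((measureReal_biUnion_finset_le _ _).trans ?_)
    · intro x hx
      by_contra hcon
      simp only [Finset.mem_univ, Set.iUnion_true, Set.mem_iUnion, not_exists] at hcon
      have hiff : ∀ j, δ.label x = j ↔ itinerary G (γ n) x ∈ E j := by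
        intro j
        have h1 := hcon j
        rw [Set.mem_symmDiff] at h1
        have h2 : x ∈ δ.atom j ↔ δ.label x = j := Iff.rfl
        have h3 : x ∈ {x | itinerary G (γ n) x ∈ E j} ↔ itinerary G (γ n) x ∈ E j := Iff.rfl
        rw [h2, h3] at h1
        tauto
      refine hx ?_
      have hex : ∃ j, itinerary G (γ n) x ∈ E j := ⟨_, (hiff _).1 rfl⟩
      simp only [dif_pos hex]
      exact (hiff _).2 hex.choose_spec
    · refine (Finset.sum_le_card_nsmul _ _ _ fun j _ => hμ j).trans (le_of_eq ?_)
      rw [Finset.card_univ, Fintype.card_fin, nsmul_eq_mul]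
      field_simp

end

/-! ### Truncations of a countable partition -/

/-- The index `min a N` as an element of `{0, …, N}`. -/
def capFin (N a : ℕ) : Fin (N + 1) := ⟨min a N, Nat.lt_succ_of_le (min_le_right _ _)⟩

/-- The finite partition obtained from `α` by merging all atoms with index at least `N`. -/
def OrdPartition.truncation {X : Type*} [MeasurableSpace X] (α : OrdPartition X ℕ) (N : ℕ) :
    OrdPartition X (Fin (N + 1)) where
  label x := capFin N (α.label x)
  measurableSet_fiber i := α.measurable_label (t := {a | capFin N a = i}) trivial

section

variable {X : Type*} [MeasurableSpace X] {μ : Measure X}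

theorem isChain_truncation (μ : Measure X) (α : OrdPartition X ℕ) {φ : ℕ → ℕ}
    (hφ : StrictMono φ) :
    IsChain μ α (fun n => φ n + 1) (fun n => α.truncation (φ n)) where
  mono n := by
    refine refines_of_comp μ fun x y h => ?_
    have := hφ (Nat.lt_add_one n)
    simp only [OrdPartition.truncation, capFin, Fin.mk.injEq] at h ⊢
    omega
  le n := by
    refine refines_of_comp μ fun x y h => ?_
    simp only [OrdPartition.truncation, capFin, Fin.mk.injEq]
    omega
  join := by
    refine refines_of_comp μ fun x y h => ?_
    have h' := congrFun h (α.label x + α.label y + 1)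
    have := hφ.id_le (α.label x + α.label y + 1)
    simp only [OrdPartition.truncation, capFin, Fin.mk.injEq, id] at h' this
    omega

theorem truncation_atom_castSucc (α : OrdPartition X ℕ) {N : ℕ} (i : Fin N) :
    (α.truncation N).atom i.castSucc = α.atom i := by
  ext x
  have := i.isLt
  simp only [OrdPartition.atom, OrdPartition.truncation, capFin, Set.mem_preimage, Set.mem_singleton_iff,
    Fin.ext_iff, Fin.val_castSucc]
  omega

theorem truncation_atom_last (α : OrdPartition X ℕ) (N : ℕ) :
    (α.truncation N).atom (Fin.last N) = {x | N ≤ α.label x} := by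
  ext x
  simp [OrdPartition.atom, OrdPartition.truncation, capFin, Fin.ext_iff]

theorem tendsto_measureReal_tail [IsFiniteMeasure μ] (α : OrdPartition X ℕ) :
    Tendsto (fun N => μ.real {x | N ≤ α.label x}) atTop (𝓝 0) := by
  have h : ⋂ N : ℕ, {x | N ≤ α.label x} = ∅ := by
    refine Set.eq_empty_of_forall_notMem fun x hx => ?_
    have h' : α.label x + 1 ≤ α.label x := Set.mem_iInter.1 hx (α.label x + 1)
    omega
  have := tendsto_measure_iInter_atTop (μ := μ) (s := fun N : ℕ => {x | N ≤ α.label x})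
    (fun N => (α.measurable_label (t := {a | N ≤ a}) trivial).nullMeasurableSet)
    (fun a b hab x hx => le_trans hab hx) ⟨0, measure_ne_top _ _⟩
  rw [h, measure_empty] at this
  exact (ENNReal.tendsto_toReal ENNReal.zero_ne_top).comp this

theorem summable_negMulLog [IsProbabilityMeasure μ] {α : OrdPartition X ℕ}
    (h : shannonEntropy μ α < ⊤) : Summable fun i => Real.negMulLog (μ.real (α.atom i)) := by
  have := ENNReal.summable_toReal h.ne
  refine this.congr fun i => ENNReal.toReal_ofReal ?_
  exact Real.negMulLog_nonneg measureReal_nonneg measureReal_le_one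

/-- Weights witnessing that the fine truncations of a partition of finite entropy have small
entropy relative to a fixed coarse one. -/
theorem exists_truncation_weights [IsProbabilityMeasure μ] {α : OrdPartition X ℕ}
    (h : shannonEntropy μ α < ⊤) {κ : ℝ} (hκ : 0 < κ) :
    ∃ N₀ : ℕ, ∀ N ≥ N₀, ∃ w : Fin (N + 1) → ℝ, (∀ i, 0 < w i) ∧
      (∀ j : Fin (N₀ + 1), ∑ i with capFin N₀ (i : Fin (N + 1)).val = j, w i ≤ 1 + κ) ∧
      ∑ i, μ.real ((α.truncation N).atom i) * -Real.log (w i) ≤ κ := by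
  set f : ℕ → ℝ := fun i => Real.negMulLog (μ.real (α.atom i)) with hf
  have hf0 : ∀ i, 0 ≤ f i := fun i =>
    Real.negMulLog_nonneg measureReal_nonneg measureReal_le_one
  have hsum : Summable f := summable_negMulLog h
  have h₁ : ∀ᶠ N₀ in atTop, ∑' i, f (i + N₀) < κ / 2 :=
    (tendsto_sum_nat_add f).eventually (gt_mem_nhds (half_pos hκ))
  have h₂ : ∀ᶠ N in atTop, Real.negMulLog (μ.real {x | N ≤ α.label x}) < κ / 2 := by
    have := (Real.continuous_negMulLog.tendsto 0).comp (tendsto_measureReal_tail (μ := μ) α)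
    rw [Real.negMulLog_zero] at this
    exact this.eventually (gt_mem_nhds (half_pos hκ))
  obtain ⟨N₀, hN₁, hN₂⟩ := (h₁.and (eventually_forall_ge_atTop.2 h₂)).exists
  refine ⟨N₀, fun N hN => ?_⟩
  set P : Fin (N + 1) → ℝ := fun i => μ.real ((α.truncation N).atom i) with hP
  have hP0 : ∀ i, 0 ≤ P i := fun i => measureReal_nonneg
  have hPsum : ∑ i, P i ≤ 1 := by
    have := sum_measureReal_preimage_singleton (μ := μ) Finset.univ
      (fun i _ => (α.truncation N).measurableSet_fiber i)
    simp only [hP, OrdPartition.atom]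
    rw [this]
    exact measureReal_le_one
  have ht : 0 < κ / (N + 2) := by positivity
  -- A coarse label below `N₀` determines the fine one, so weight 1 costs nothing. In the tail the
  -- weight is the probability, whose cost is the tail entropy; null atoms get a positive filler,
  -- and at most `N + 1` of these sum to less than `κ`.
  refine ⟨fun i => if (i : ℕ) < N₀ then 1 else if P i = 0 then κ / (N + 2) else P i,
    fun i => ?_, fun j => ?_, ?_⟩
  · dsimp only
    split_ifs with h1 h2
    · exact one_pos
    · exact ht
    · exact lt_of_le_of_ne (hP0 i) (Ne.symm h2)
  · by_cases hj : (j : ℕ) < N₀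
    · have hcard : (Finset.univ.filter fun i : Fin (N + 1) =>
          capFin N₀ i = j).card ≤ 1 := by
        rw [Finset.card_le_one]
        intro a ha b hb
        simp only [Finset.mem_filter, Finset.mem_univ, true_and, Fin.ext_iff, capFin] at ha hb ⊢
        omega
      refine (Finset.sum_le_card_nsmul _ _ 1 fun i hi => ?_).trans ?_
      · simp only [Finset.mem_filter, Finset.mem_univ, true_and, Fin.ext_iff, capFin] at hi
        exact (if_pos (by omega)).le
      · rw [nsmul_eq_mul, mul_one]
        have : ((Finset.univ.filter fun i : Fin (N + 1) =>
          capFin N₀ i = j).card : ℝ) ≤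
            1 := by exact_mod_cast hcard
        linarith
    · calc _ ≤ ∑ i with capFin N₀ (i : Fin (N + 1)).val = j, (P i + κ / (N + 2)) := by
            refine Finset.sum_le_sum fun i hi => ?_
            simp only [Finset.mem_filter, Finset.mem_univ, true_and, Fin.ext_iff, capFin] at hi
            rw [if_neg (by omega)]
            split_ifs
            · linarith [hP0 i]
            · linarith
        _ ≤ ∑ i, (P i + κ / (N + 2)) :=
            Finset.sum_le_sum_of_subset_of_nonneg (Finset.subset_univ _) fun i _ _ => by
              linarith [hP0 i]
        _ = ∑ i, P i + (N + 1) * (κ / (N + 2)) := by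
            rw [Finset.sum_add_distrib]; simp
        _ ≤ 1 + κ := by
            have : (N + 1) * (κ / (N + 2)) ≤ (N + 2) * (κ / (N + 2)) := by gcongr; linarith
            have h' : (N + 2) * (κ / ((N : ℝ) + 2)) = κ := by field_simp
            linarith
  · calc ∑ i, P i * -Real.log (if (i : ℕ) < N₀ then 1 else if P i = 0 then κ / (N + 2) else P i)
        = ∑ i : Fin (N + 1), if (i : ℕ) < N₀ then 0 else Real.negMulLog (P i) := by
          refine Finset.sum_congr rfl fun i _ => ?_
          split_ifs with h1 h2
          · simp
          · simp [h2]
          · simp [Real.negMulLog]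
      -- The last atom of the truncation merges all indices from `N` on; its entropy term is
      -- controlled by `h₂` rather than by the series.
      _ = (∑ i ∈ Finset.range N, if i < N₀ then 0 else f i) +
            Real.negMulLog (μ.real {x | N ≤ α.label x}) := by
          rw [Fin.sum_univ_castSucc]
          congr 1
          · rw [← Fin.sum_univ_eq_sum_range (fun i => if i < N₀ then 0 else f i)]
            refine Finset.sum_congr rfl fun i _ => ?_
            simp only [hP, hf, truncation_atom_castSucc, Fin.val_castSucc]
          · simp only [hP, truncation_atom_last, Fin.val_last, if_neg (not_lt.2 hN)]
      _ ≤ κ / 2 + κ / 2 := by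
          refine add_le_add ?_ (hN₂ N hN).le
          have : ∑ i ∈ Finset.range N, (if i < N₀ then 0 else f i) = ∑ i ∈ Finset.Ico N₀ N, f i := by
            rw [Finset.range_eq_Ico, ← Finset.sum_Ico_consecutive _ (Nat.zero_le N₀) hN,
              Finset.sum_eq_zero, zero_add]
            · refine Finset.sum_congr rfl fun i hi => ?_
              rw [if_neg (not_lt.2 (Finset.mem_Ico.1 hi).1)]
            · intro i hi
              rw [if_pos (Finset.mem_Ico.1 hi).2]
          rw [this, Finset.sum_Ico_eq_sum_range]
          refine le_trans ?_ hN₁.le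
          have hs : Summable fun i => f (i + N₀) := (summable_nat_add_iff N₀).2 hsum
          refine le_trans (le_of_eq ?_) (hs.sum_le_tsum (Finset.range (N - N₀)) fun i _ => hf0 _)
          exact Finset.sum_congr rfl fun i _ => by rw [add_comm]
      _ = κ := by ring

end

/-! ### Independence of the partition -/

/-- The damping `t` is fixed first; the error rate `θ` is then made small against `-log t`. -/
theorem exists_small_parameters {M K : ℝ} (hM : 0 ≤ M) (hK : 0 < K) :
    ∃ t θ : ℝ, 0 < t ∧ t ≤ 1 ∧ 0 < θ ∧ t * M ≤ K ∧ 2 * θ * -Real.log t ≤ K := by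
  refine ⟨min 1 (K / (M + 1)), K / (2 * (-Real.log (min 1 (K / (M + 1))) + 1)), ?_,
    min_le_left _ _, ?_, ?_, ?_⟩
  · exact lt_min one_pos (by positivity)
  all_goals
    have ht : 0 < min 1 (K / (M + 1)) := lt_min one_pos (by positivity)
    have ht1 : min 1 (K / (M + 1)) ≤ 1 := min_le_left _ _
    have htK : min 1 (K / (M + 1)) ≤ K / (M + 1) := min_le_right _ _
    generalize min 1 (K / (M + 1)) = t at *
    have hl : 0 ≤ -Real.log t := by linarith [Real.log_nonpos ht.le ht1]
    generalize -Real.log t = a at *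
  · positivity
  · rw [le_div_iff₀ (by linarith)] at htK
    linarith
  · rw [show 2 * (K / (2 * (a + 1))) * a = K * (a / (a + 1)) by field_simp]
    have : a / (a + 1) ≤ 1 := by rw [div_le_one (by linarith)]; linarith
    nlinarith

section

variable {G : Type*} [Group G] {X : Type*} [MeasurableSpace X] [MulAction G X]
  [MeasurableConstSMul G X] {μ : Measure X} [IsProbabilityMeasure μ] [SMulInvariantMeasure G X μ]

theorem OrdPartition.neZero_of_isProbabilityMeasure (μ : Measure X) [IsProbabilityMeasure μ]
    {k : ℕ} (δ : OrdPartition X (Fin k)) : NeZero k := by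
  obtain ⟨x⟩ := nonempty_of_isProbabilityMeasure μ
  exact ⟨fun h => by subst h; exact (δ.label x).elim0⟩

/-- Any chain `δ` of `β` and window `F` are beaten by the truncations of `α` at a larger window. The
choices are made in the order `κ`, `N₀`, then `t` and `θ`, then `n` and `d`, then `ε₀`, `θ'` and the
window of `c`. -/
theorem meanEntropy_le_of_isGenerating {S : MapSequence G} (hS : S.IsSoficApproximation)
    {α β : OrdPartition X ℕ} (hα : IsGenerating G μ α) (hβ : IsGenerating G μ β)
    (hH : shannonEntropy μ α < ⊤) : meanEntropy S μ α ≤ meanEntropy S μ β := by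
  classical
  refine le_iInf fun F => le_sInf ?_
  rintro L ⟨v, δ, hδ, hL⟩
  refine EReal.le_of_forall_lt_iff_le.1 fun z hz => ?_
  obtain ⟨z', hz', hz'z⟩ := EReal.lt_iff_exists_real_btwn.1 hz
  rw [EReal.coe_lt_coe_iff] at hz'z
  -- Four errors of size at most `κ` must stay strictly below `z - z' = 8 * κ`: the excess of the
  -- weights, the damped weights, the tail cost and the decoding mistakes.
  have hK : 0 < (z - z') / 8 := by linarith
  set κ := (z - z') / 8 with hκ
  obtain ⟨N₀, hN₀⟩ := exists_truncation_weights hH hK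
  obtain ⟨t, θ, ht0, ht1, hθ, htM, hθt⟩ := exists_small_parameters
    (M := ((N₀ + 1 : ℕ) : ℝ) * (1 + κ)) (by positivity) hK
  obtain ⟨n₀, F₂, hn₀⟩ := exists_code_of_approximable (G := G) (γ := δ) (α.truncation N₀)
    (fun j => hδ.approximable_of_isGenerating hβ ((α.truncation N₀).measurableSet_fiber j)) hθ
  obtain ⟨n, hnn₀, hn⟩ := ((eventually_ge_atTop n₀).and
    (hL.eventually (gt_mem_nhds hz'))).exists
  obtain ⟨d, hd, hdα⟩ := hn₀ n hnn₀
  obtain ⟨⟨ε₀, hε₀⟩, hε₀'⟩ := iInf_lt_iff.1 hn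
  simp only at hε₀'
  have hchain : IsChain μ α (fun n => n + 1) (fun n => α.truncation n) :=
    isChain_truncation μ α strictMono_id
  have : NeZero (v n) := (δ n).neZero_of_isProbabilityMeasure μ
  -- The code `c` must be right on all translates by `F₂`, so that `d` still decodes, and by `F`, so
  -- that the coded model is within `ε₀`.
  set θ' := min (θ / (F₂.card + 1)) (ε₀ / (4 * (F.card + 1))) with hθ'
  have hθ'0 : 0 < θ' := lt_min (by positivity) (by positivity)
  have hθ'₁ : F₂.card * θ' ≤ θ := by
    calc F₂.card * θ' ≤ (F₂.card + 1) * (θ / (F₂.card + 1)) := by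
          gcongr
          · linarith
          · exact min_le_left _ _
      _ = θ := by field_simp
  have hθ'₂ : 2 * (F.card * θ') < ε₀ := by
    have : F.card * θ' ≤ (F.card + 1) * (ε₀ / (4 * (F.card + 1))) := by
      gcongr
      · linarith
      · exact min_le_right _ _
    have e : (F.card + 1) * (ε₀ / (4 * ((F.card : ℝ) + 1))) = ε₀ / 4 := by field_simp
    linarith
  obtain ⟨n₁, F₁, hn₁⟩ := exists_code_of_approximable (G := G) (μ := μ) (δ n)
    (fun j => hchain.approximable_of_isGenerating hα ((δ n).measurableSet_fiber j)) hθ'0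
  set F' := insert 1 (F * F₁ ∪ F₂ * F₁)
  have key : ∀ N ≥ max n₁ N₀, entropyFin S μ (α.truncation N) F' ≤ (z : EReal) := by
    intro N hN
    obtain ⟨c, hc, hcδ⟩ := hn₁ N (le_of_max_le_left hN)
    obtain ⟨w, hw, hws, hwκ⟩ := hN₀ N (le_of_max_le_right hN)
    have hπ : ∀ x, capFin N₀ ((α.truncation N).label x) = (α.truncation N₀).label x := by
      intro x
      have := le_of_max_le_right hN
      simp only [OrdPartition.truncation, capFin, Fin.mk.injEq]
      omega
    refine (entropyFin_le_of_codes hS hw hws hc hd hcδ (θ := θ) ?_ ht0 ht1 hθ'₂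
      (B := z - z') ?_).trans ?_
    · simpa only [hπ] using hdα
    · have hlt : 0 ≤ -Real.log t := by linarith [Real.log_nonpos ht0.le ht1]
      have : (θ + F₂.card * θ') * -Real.log t ≤ 2 * θ * -Real.log t := by
        gcongr
        linarith
      linarith
    · calc entropyFinEps S μ (δ n) F ε₀ + ((z - z' : ℝ) : EReal)
          ≤ (z' : EReal) + ((z - z' : ℝ) : EReal) := by gcongr
        _ = (z : EReal) := by
          rw [← EReal.coe_add]
          congr 1
          ring
  -- The definition asks for a chain with convergent entropies; compactness of `EReal` gives a
  -- subsequence, which is again a chain.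
  obtain ⟨a, φ, hφ, ha⟩ := CompactSpace.tendsto_subseq
    (fun N => entropyFin S μ (α.truncation N) F')
  have ha' : entropyF S μ α F' ≤ a := sInf_le ⟨_, _, isChain_truncation μ α hφ, ha⟩
  refine (iInf_le _ F').trans (ha'.trans ?_)
  refine le_of_tendsto ha ?_
  filter_upwards [hφ.tendsto_atTop.eventually (eventually_ge_atTop (max n₁ N₀))] with N hN
  exact key _ hN

theorem isChain_const (μ : Measure X) [IsProbabilityMeasure μ] {u : ℕ}
    (α : OrdPartition X (Fin u)) : IsChain μ α.toNat (fun _ => u) (fun _ => α) := by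
  have := α.neZero_of_isProbabilityMeasure μ
  refine ⟨fun _ => ?_, fun _ => ?_, ?_⟩
  · exact refines_of_comp μ fun x y h => h
  · exact refines_of_comp μ fun x y h => Fin.ext h
  · exact refines_of_comp μ fun x y h => congrArg Fin.val (congrFun h 0)

/-- The constant chain gives one inequality. For the other, each `δ n` is almost everywhere a
function of `α`, so `c` is exact with window `{1}`, and atoms of `α` are approximable along its own
chain without any generation; with `π = id` and unit weights only decoding mistakes cost anything.
-/
theorem meanEntropyFin_eq {S : MapSequence G} (hS : S.IsSoficApproximation) {u : ℕ}
    (α : OrdPartition X (Fin u)) : meanEntropyFin S μ α = meanEntropy S μ α.toNat := by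
  classical
  refine le_antisymm ?_ ?_
  · refine le_iInf fun F => le_sInf ?_
    rintro L ⟨v, δ, hδ, hL⟩
    refine EReal.le_of_forall_lt_iff_le.1 fun z hz => ?_
    obtain ⟨z', hz', hz'z⟩ := EReal.lt_iff_exists_real_btwn.1 hz
    rw [EReal.coe_lt_coe_iff] at hz'z
    have hK : 0 < (z - z') / 8 := by linarith
    set κ := (z - z') / 8 with hκ
    obtain ⟨t, θ, ht0, ht1, hθ, htM, hθt⟩ := exists_small_parameters
      (M := (u : ℝ)) (by positivity) hK
    have := α.neZero_of_isProbabilityMeasure μ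
    obtain ⟨n₀, F₂, hn₀⟩ := exists_code_of_approximable (G := G) (γ := δ) α (fun j => by
      have := hδ.approximable_atom (G := G) (j : ℕ)
      have e : α.toNat.atom (j : ℕ) = α.atom j := by
        ext x; simp [OrdPartition.atom, OrdPartition.toNat, Fin.ext_iff]
      rwa [e] at this) hθ
    obtain ⟨n, hnn₀, hn⟩ := ((eventually_ge_atTop n₀).and
      (hL.eventually (gt_mem_nhds hz'))).exists
    obtain ⟨d, hd, hdα⟩ := hn₀ n hnn₀
    obtain ⟨⟨ε₀, hε₀⟩, hε₀'⟩ := iInf_lt_iff.1 hn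
    simp only at hε₀'
    obtain ⟨ρ, hρ⟩ := (hδ.le n).exists_map
    refine (iInf_le _ (insert 1 (F * {1} ∪ F₂ * {1}))).trans ?_
    refine (entropyFin_le_of_codes hS (γ := α) (δ := δ n) (π := id) (w := fun _ => 1) (s := 0)
      (θ' := 0) (c := fun w => ρ (w 1)) (F₁ := {1}) (d := d) (fun _ => one_pos) (fun j => ?_) ?_
      hd ?_ (θ := θ) (by simpa using hdα) ht0 ht1 (ε₀ := ε₀) (by simpa using hε₀)
      (B := z - z') ?_).trans ?_
    · simp [Finset.filter_eq']
    · intro w w' h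
      have : w 1 = w' 1 := h 1 (by simp)
      simp [this]
    · have h0 : μ {x | (δ n).label x ≠ ρ (itinerary G α x 1 : Fin u)} = 0 := by
        refine measure_mono_null (fun x hx => ?_) (ae_iff.1 hρ)
        simpa [itinerary, OrdPartition.toNat] using hx
      rw [measureReal_def, h0, ENNReal.toReal_zero]
    · have hlt : 0 ≤ -Real.log t := by linarith [Real.log_nonpos ht0.le ht1]
      have : θ * -Real.log t ≤ 2 * θ * -Real.log t := by
        gcongr
        linarith
      simp only [mul_zero, add_zero, Real.log_one, neg_zero, Finset.sum_const_zero, mul_one,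
        zero_add]
      linarith
    · calc entropyFinEps S μ (δ n) F ε₀ + ((z - z' : ℝ) : EReal)
          ≤ (z' : EReal) + ((z - z' : ℝ) : EReal) := by gcongr
        _ = (z : EReal) := by
          rw [← EReal.coe_add]
          congr 1
          ring
  · refine le_iInf fun F => (iInf_le _ F).trans (sInf_le ?_)
    exact ⟨_, _, isChain_const μ α, tendsto_const_nhds⟩

theorem systemEntropy_eq {S : MapSequence G} (hS : S.IsSoficApproximation)
    {α : OrdPartition X ℕ} (hα : IsGenerating G μ α) (hH : shannonEntropy μ α < ⊤) :
    systemEntropy S μ = some (meanEntropy S μ α) := by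
  have h : ∃ α : OrdPartition X ℕ, IsGenerating G μ α ∧ shannonEntropy μ α < ⊤ := ⟨α, hα, hH⟩
  rw [systemEntropy, dif_pos h]
  congr 1
  exact le_antisymm (meanEntropy_le_of_isGenerating hS h.choose_spec.1 hα h.choose_spec.2)
    (meanEntropy_le_of_isGenerating hS hα h.choose_spec.1 hH)

end

/-! ### Measure conjugacy -/

section

variable {G : Type*} [Group G] {X Y : Type*} [MeasurableSpace X] [MulAction G X]
  [MeasurableSpace Y] [MulAction G Y] {μ : Measure X} {ν : Measure Y}

/-- The image under `φ` of the trace of a measurable `A` is the trace on `Y'` of a measurable `B`;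
the measure identity is applied to `B`, and conull sets are discarded. -/
theorem MeasurablyConjugate.symm (h : MeasurablyConjugate G μ ν) : MeasurablyConjugate G ν μ := by
  obtain ⟨X', Y', φ, hX, hY, hpush, hequi⟩ := h
  refine ⟨Y', X', φ.symm, hY, hX, fun A hA => ?_, fun g y => ?_⟩
  · obtain ⟨B, hB, hAB⟩ : MeasurableSet {y : Y' | (φ.symm y : X) ∈ A} :=
      (measurable_subtype_coe.comp φ.symm.measurable) hA
    have h₁ : Subtype.val '' {y : Y' | (φ.symm y : X) ∈ A} = B ∩ Y' := by
      rw [← hAB, Subtype.image_preimage_coe, Set.inter_comm]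
    have h₂ : Subtype.val '' {x : X' | (φ x : Y) ∈ B} = A ∩ X' := by
      ext x
      simp only [Set.mem_image, Set.mem_ofPred_eq, Subtype.exists, exists_and_right,
        exists_eq_right, Set.mem_inter_iff]
      have key : ∀ hx : x ∈ X', (φ ⟨x, hx⟩ : Y) ∈ B ↔ x ∈ A := by
        intro hx
        have : φ ⟨x, hx⟩ ∈ Subtype.val ⁻¹' B ↔ φ ⟨x, hx⟩ ∈ {y : Y' | (φ.symm y : X) ∈ A} := by
          rw [hAB]
        simpa using this
      constructor
      · rintro ⟨hx, hB⟩; exact ⟨(key hx).1 hB, hx⟩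
      · rintro ⟨hA, hx⟩; exact ⟨hx, (key hx).2 hA⟩
    rw [h₁, measure_inter_conull hY, ← hpush B hB, h₂, measure_inter_conull hX]
  · obtain ⟨hx, hgx⟩ := hequi g (φ.symm y)
    rw [φ.apply_symm_apply] at hgx
    have hy : g • (y : Y) ∈ Y' := hgx ▸ (φ _).2
    refine ⟨hy, ?_⟩
    have : (⟨g • (y : Y), hy⟩ : Y') = φ ⟨g • (φ.symm y : X), hx⟩ := Subtype.ext hgx.symm
    rw [this, φ.symm_apply_apply]

/-! ### Transport of sets, partitions and chains along a conjugacy -/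

variable {X' : Set X} {Y' : Set Y} {φ : X' ≃ᵐ Y'}

/-- `X'` is not assumed measurable, so extension by a constant is unavailable; instead a function
measurable for the trace σ-algebra factors measurably through the inclusion. -/
theorem exists_transported_partition (φ : X' ≃ᵐ Y') {ι : Type*} [Countable ι] [Nonempty ι]
    (β : OrdPartition Y ι) :
    ∃ α : OrdPartition X ι, ∀ x : X', α.label (x : X) = β.label (φ x : Y) := by
  let _ : MeasurableSpace ι := ⊤
  have : DiscreteMeasurableSpace ι := ⟨fun _ => trivial⟩
  have hm : Measurable fun x : X' => β.label (φ x : Y) :=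
    β.measurable_label.comp (measurable_subtype_coe.comp φ.measurable)
  obtain ⟨f, hf, hfβ⟩ := Measurable.exists_eq_measurable_comp hm
  exact ⟨⟨f, fun i => hf trivial⟩, fun x => (congrFun hfβ x).symm⟩

theorem measure_eq_of_corresponds (hX : μ X'ᶜ = 0)
    (hpush : ∀ B : Set Y, MeasurableSet B → μ (Subtype.val '' {x : X' | (φ x : Y) ∈ B}) = ν B)
    {A : Set X} {B : Set Y} (hB : MeasurableSet B) (h : ∀ x : X', (x : X) ∈ A ↔ (φ x : Y) ∈ B) :
    μ A = ν B := by
  rw [← hpush B hB, ← measure_inter_conull hX]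
  congr 1
  ext x
  constructor
  · rintro ⟨hA, hx⟩; exact ⟨⟨x, hx⟩, (h ⟨x, hx⟩).1 hA, rfl⟩
  · rintro ⟨x, hxB, rfl⟩; exact ⟨(h x).2 hxB, x.2⟩

theorem corresponds_smul
    (hequi : ∀ (g : G) (x : X'), ∃ hx : g • (x : X) ∈ X',
      (φ ⟨g • (x : X), hx⟩ : Y) = g • (φ x : Y))
    {A : Set X} {B : Set Y} (h : ∀ x : X', (x : X) ∈ A ↔ (φ x : Y) ∈ B) (g : G) (x : X') :
    (x : X) ∈ g • A ↔ (φ x : Y) ∈ g • B := by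
  obtain ⟨hx, hgx⟩ := hequi g⁻¹ x
  rw [Set.mem_smul_set_iff_inv_smul_mem, Set.mem_smul_set_iff_inv_smul_mem, ← hgx]
  exact h ⟨_, hx⟩

theorem invariantSigma_le [MeasurableConstSMul G X] {ι : Type*} (α : OrdPartition X ι)
    {A : Set X} (hA : MeasurableSet[invariantSigma G α.atom] A) : MeasurableSet A :=
  MeasurableSpace.measurableSet_sInf.1 hA _
    ⟨fun g _ hs => hs.const_smul g, α.measurableSet_fiber⟩

theorem isGenerating_of_corresponds [MeasurableConstSMul G X] [MeasurableConstSMul G Y]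
    (hX : μ X'ᶜ = 0)
    (hpush : ∀ B : Set Y, MeasurableSet B → μ (Subtype.val '' {x : X' | (φ x : Y) ∈ B}) = ν B)
    (hequi : ∀ (g : G) (x : X'), ∃ hx : g • (x : X) ∈ X',
      (φ ⟨g • (x : X), hx⟩ : Y) = g • (φ x : Y))
    {α : OrdPartition X ℕ} {β : OrdPartition Y ℕ}
    (hαβ : ∀ x : X', α.label (x : X) = β.label (φ x : Y)) (hβ : IsGenerating G ν β) :
    IsGenerating G μ α := by
  intro A hA
  obtain ⟨B, hB, hAB⟩ : MeasurableSet {y : Y' | (φ.symm y : X) ∈ A} :=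
    (measurable_subtype_coe.comp φ.symm.measurable) hA
  have hAB' : ∀ x : X', (x : X) ∈ A ↔ (φ x : Y) ∈ B := by
    intro x
    have : φ x ∈ Subtype.val ⁻¹' B ↔ φ x ∈ {y : Y' | (φ.symm y : X) ∈ A} := by rw [hAB]
    simpa using this.symm
  obtain ⟨B', hB', hBB'⟩ := hβ B hB
  -- The sets of `Y` that correspond on `X'` to a member of `invariantSigma G α.atom` form an
  -- invariant σ-algebra containing the atoms of `β`.
  have : MeasurableSet[((invariantSigma G α.atom).comap (Subtype.val : X' → X)).map
      fun x => (φ x : Y)] B' := by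
    refine MeasurableSpace.measurableSet_sInf.1 hB' _ ⟨?_, fun i => ?_⟩
    · rintro g B ⟨A, hA, h⟩
      refine ⟨g • A, ?_, Set.ext fun x => corresponds_smul hequi (Set.ext_iff.1 h) g x⟩
      exact MeasurableSpace.measurableSet_sInf.2 fun m hm =>
        hm.1 g A (MeasurableSpace.measurableSet_sInf.1 hA m hm)
    · refine ⟨α.atom i, MeasurableSpace.measurableSet_sInf.2 fun m hm => hm.2 i,
        Set.ext fun x => ?_⟩
      simp only [OrdPartition.atom, Set.mem_preimage, hαβ]
  obtain ⟨A', hA', hAA'⟩ := this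
  have hAB'' : ∀ x : X', (x : X) ∈ A' ↔ (φ x : Y) ∈ B' := Set.ext_iff.1 hAA'
  refine ⟨A', hA', ?_⟩
  rw [measure_eq_of_corresponds hX hpush (hB.symmDiff (invariantSigma_le β hB')), hBB']
  intro x
  simp only [Set.mem_symmDiff, hAB', hAB'']

theorem shannonEntropy_eq_of_corresponds (hX : μ X'ᶜ = 0)
    (hpush : ∀ B : Set Y, MeasurableSet B → μ (Subtype.val '' {x : X' | (φ x : Y) ∈ B}) = ν B)
    {α : OrdPartition X ℕ} {β : OrdPartition Y ℕ}
    (hαβ : ∀ x : X', α.label (x : X) = β.label (φ x : Y)) :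
    shannonEntropy μ α = shannonEntropy ν β := by
  unfold shannonEntropy
  refine tsum_congr fun i => ?_
  rw [measureReal_def, measureReal_def, measure_eq_of_corresponds (φ := φ) hX hpush
    (β.measurableSet_fiber i)]
  · rfl
  · intro x
    simp only [OrdPartition.atom, Set.mem_preimage, hαβ]

theorem entropyFin_eq_of_corresponds [MeasurableConstSMul G Y] (S : MapSequence G)
    (hX : μ X'ᶜ = 0)
    (hpush : ∀ B : Set Y, MeasurableSet B → μ (Subtype.val '' {x : X' | (φ x : Y) ∈ B}) = ν B)
    (hequi : ∀ (g : G) (x : X'), ∃ hx : g • (x : X) ∈ X',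
      (φ ⟨g • (x : X), hx⟩ : Y) = g • (φ x : Y))
    {u : ℕ} {α : OrdPartition X (Fin u)} {β : OrdPartition Y (Fin u)}
    (hαβ : ∀ x : X', α.label (x : X) = β.label (φ x : Y)) (F : Finset G) :
    entropyFin S μ α F = entropyFin S ν β F := by
  have h : ∀ ψ : F → Fin u, μ.real (⋂ f : F, (f : G) • α.atom (ψ f)) =
      ν.real (⋂ f : F, (f : G) • β.atom (ψ f)) := by
    intro ψ
    rw [measureReal_def, measureReal_def, measure_eq_of_corresponds (φ := φ) hX hpush
      (MeasurableSet.iInter fun f : F => (β.measurableSet_fiber (ψ f)).const_smul (f : G))]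
    · rfl
    · intro x
      simp only [Set.mem_iInter]
      refine forall_congr' fun f => corresponds_smul hequi (fun x => ?_) _ x
      simp only [OrdPartition.atom, Set.mem_preimage, hαβ]
  simp only [entropyFin, entropyFinEps, approxPartitions, distF, h]

/-- Every chain of `β` pulls back to a chain of `α` with the same entropies, so the infimum for `α`
runs over at least as many values. -/
theorem meanEntropy_le_of_corresponds [MeasurableConstSMul G Y] (S : MapSequence G)
    [IsProbabilityMeasure ν] (hX : μ X'ᶜ = 0)
    (hpush : ∀ B : Set Y, MeasurableSet B → μ (Subtype.val '' {x : X' | (φ x : Y) ∈ B}) = ν B)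
    (hequi : ∀ (g : G) (x : X'), ∃ hx : g • (x : X) ∈ X',
      (φ ⟨g • (x : X), hx⟩ : Y) = g • (φ x : Y))
    {α : OrdPartition X ℕ} {β : OrdPartition Y ℕ}
    (hαβ : ∀ x : X', α.label (x : X) = β.label (φ x : Y)) :
    meanEntropy S μ α ≤ meanEntropy S ν β := by
  refine le_iInf fun F => (iInf_le _ F).trans (sInf_le_sInf ?_)
  rintro L ⟨u, δ, hδ, hL⟩
  have (n : ℕ) : Nonempty (Fin (u n)) := by
    have := (δ n).neZero_of_isProbabilityMeasure ν
    exact ⟨0⟩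
  choose γ hγ using fun n => exists_transported_partition φ (δ n)
  have hnull : ∀ {A : Set X} {B : Set Y}, MeasurableSet B →
      (∀ x : X', (x : X) ∈ A ↔ (φ x : Y) ∈ B) → ν B = 0 → μ A = 0 :=
    fun hB h h0 => (measure_eq_of_corresponds hX hpush hB h).trans h0
  refine ⟨u, γ, ⟨fun n i => ?_, fun n i => ?_, fun i => ?_⟩, ?_⟩
  · obtain ⟨j, hj⟩ := hδ.mono n i
    refine ⟨j, hnull (((δ (n + 1)).measurableSet_fiber i).diff ((δ n).measurableSet_fiber j))
      (fun x => ?_) hj⟩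
    simp [hγ]
  · obtain ⟨j, hj⟩ := hδ.le n i
    refine ⟨j, hnull ((β.measurableSet_fiber i).diff ((δ n).measurableSet_fiber j))
      (fun x => ?_) hj⟩
    simp [hγ, hαβ]
  · obtain ⟨j, hj⟩ := hδ.join i
    refine ⟨j, hnull (MeasurableSet.diff ?_ (β.measurableSet_fiber j)) (fun x => ?_) hj⟩
    · have : (fun x n => (δ n).label x) ⁻¹' {i} = ⋂ n, (δ n).label ⁻¹' {i n} := by
        ext x; simp [funext_iff]
      rw [this]
      exact MeasurableSet.iInter fun n => (δ n).measurableSet_fiber (i n)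
    · simp [hγ, hαβ]
  · simpa only [entropyFin_eq_of_corresponds S hX hpush hequi (hγ _)] using hL

/-- A generating partition of finite entropy is carried over by a conjugacy, with at most the
same mean entropy. -/
theorem MeasurablyConjugate.exists_partition [MeasurableConstSMul G X] [MeasurableConstSMul G Y]
    [IsProbabilityMeasure ν] (S : MapSequence G) (h : MeasurablyConjugate G μ ν)
    {β : OrdPartition Y ℕ} (hβ : IsGenerating G ν β) (hH : shannonEntropy ν β < ⊤) :
    ∃ α : OrdPartition X ℕ, IsGenerating G μ α ∧ shannonEntropy μ α < ⊤ ∧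
      meanEntropy S μ α ≤ meanEntropy S ν β := by
  obtain ⟨X', Y', φ, hX, -, hpush, hequi⟩ := h
  obtain ⟨α, hαβ⟩ := exists_transported_partition φ β
  exact ⟨α, isGenerating_of_corresponds hX hpush hequi hαβ hβ,
    (shannonEntropy_eq_of_corresponds hX hpush hαβ).trans_lt hH,
    meanEntropy_le_of_corresponds S hX hpush hequi hαβ⟩

theorem MeasurablyConjugate.systemEntropy_eq [MeasurableConstSMul G X] [MeasurableConstSMul G Y]
    [IsProbabilityMeasure μ] [IsProbabilityMeasure ν] [SMulInvariantMeasure G X μ]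
    [SMulInvariantMeasure G Y ν] {S : MapSequence G} (hS : S.IsSoficApproximation)
    (h : MeasurablyConjugate G μ ν) : systemEntropy S μ = systemEntropy S ν := by
  by_cases hμ : ∃ α : OrdPartition X ℕ, IsGenerating G μ α ∧ shannonEntropy μ α < ⊤
  · obtain ⟨α, hα, hHα⟩ := hμ
    obtain ⟨β, hβ, hHβ, hle⟩ := h.symm.exists_partition S hα hHα
    obtain ⟨α', hα', hHα', hle'⟩ := h.exists_partition S hβ hHβ
    -- Transport only gives inequalities; carrying `α` to `β` and back to `α'` closes the circle,
    -- since `α` and `α'` both generate.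
    have := meanEntropy_le_of_isGenerating hS hα hα' hHα
    rw [SoficEntropy.systemEntropy_eq hS hα hHα, SoficEntropy.systemEntropy_eq hS hβ hHβ]
    exact congrArg some (le_antisymm (this.trans hle') hle)
  · have hν : ¬ ∃ β : OrdPartition Y ℕ, IsGenerating G ν β ∧ shannonEntropy ν β < ⊤ := by
      rintro ⟨β, hβ, hHβ⟩
      obtain ⟨α, hα, hHα, -⟩ := h.exists_partition S hβ hHβ
      exact hμ ⟨α, hα, hHα⟩
    rw [systemEntropy, dif_neg hμ, systemEntropy, dif_neg hν]

end

end SoficEntropy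

theorem theorem2 {G : Type*} [Group G] [Countable G]
    (S : SoficEntropy.MapSequence G) (hS : S.IsSoficApproximation)
    {X : Type*} [MeasurableSpace X] [MulAction G X] [MeasurableConstSMul G X]
    (μ : MeasureTheory.Measure X) [MeasureTheory.IsProbabilityMeasure μ]
    [MeasureTheory.SMulInvariantMeasure G X μ] :
    -- the mean entropy does not depend on the generating partition
    (∀ α β : SoficEntropy.OrdPartition X ℕ,
      SoficEntropy.IsGenerating G μ α → SoficEntropy.IsGenerating G μ β →
      SoficEntropy.shannonEntropy μ α + SoficEntropy.shannonEntropy μ β < ⊤ →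
      SoficEntropy.meanEntropy S μ α = SoficEntropy.meanEntropy S μ β) ∧
    -- for finite partitions the direct definition of the mean entropy gives the same value
    (∀ (u : ℕ) (α : SoficEntropy.OrdPartition X (Fin u)),
      SoficEntropy.meanEntropyFin S μ α = SoficEntropy.meanEntropy S μ α.toNat) ∧
    -- so the entropy of the system is the mean entropy of any such partition
    (∀ α : SoficEntropy.OrdPartition X ℕ,
      SoficEntropy.IsGenerating G μ α → SoficEntropy.shannonEntropy μ α < ⊤ →
      SoficEntropy.systemEntropy S μ = some (SoficEntropy.meanEntropy S μ α)) ∧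
    -- and it is invariant under measure conjugacy
    (∀ {Y : Type*} [MeasurableSpace Y] [MulAction G Y] [MeasurableConstSMul G Y]
      (ν : MeasureTheory.Measure Y) [MeasureTheory.IsProbabilityMeasure ν]
      [MeasureTheory.SMulInvariantMeasure G Y ν],
      SoficEntropy.MeasurablyConjugate G μ ν →
      SoficEntropy.systemEntropy S μ = SoficEntropy.systemEntropy S ν) := by
  refine ⟨fun α β hα hβ hH => ?_, fun u α => SoficEntropy.meanEntropyFin_eq hS α,
    fun α hα hH => SoficEntropy.systemEntropy_eq hS hα hH,
    fun ν _ _ h => h.systemEntropy_eq hS⟩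
  rw [ENNReal.add_lt_top] at hH
  exact le_antisymm (SoficEntropy.meanEntropy_le_of_isGenerating hS hα hβ hH.1)
    (SoficEntropy.meanEntropy_le_of_isGenerating hS hβ hα hH.2)
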